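/- Let $\mathcal N$ and $\mathcal M$ be von Neumann algebras with faithful normal states $\varphi$ and $\psi$, and let $\mathcal N\otimes\mathcal M$ be their von Neumann algebra tensor product, with the product state $\omega=\varphi\otimes\psi$. For $1\le p\le\infty$ let $L^p(\mathcal N\otimes\mathcal M)=(\mathcal N\otimes\mathcal M,(\mathcal N\otimes\mathcal M)_*)_{[1/p]}$ be the non-commutative $L^p$-space, that is, the complex interpolation space of the couple given by the left injection $x\mapsto x\omega$, $(x\omega)(y)=\omega(yx)$, and let $i^p:\mathcal N\otimes\mathcal M\to L^p(\mathcal N\otimes\mathcal M)$ be the canonical embedding. Let $E_{\mathcal N}=\iota\otimes\psi:\mathcal N\otimes\mathcal M\to\mathcal N\otimes 1$ and $E_{\mathcal M}=\varphi\otimes\iota:\mathcal N\otimes\mathcal M\to 1\otimes\mathcal M$ be the $\omega$-preserving conditional expectations. Let $(u_i)_{i\ge 0}$ in $\mathcal N$ and $(v_j)_{j\ge 0}$ in $\mathcal M$ be sequences of linearly independent unitaries, and let $F^p_{\mathcal N,j}$ and $F^p_{\mathcal M,i}$ be the bounded maps on $L^p(\mathcal N\otimes\mathcal M)$ obtained by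 complex interpolation from $$F_{\mathcal N,j}(x)=(1\otimes v_j)\,E_{\mathcal N}\big((1\otimes v_j^*)x\big),\qquad F_{\mathcal M,i}(x)=(u_i\otimes 1)\,E_{\mathcal M}\big((u_i^*\otimes 1)x\big).$$ Suppose that $\big(F^p_{\mathcal N,j}(L^p(\mathcal N\otimes\mathcal M))\big)_{j\ge0}$ and $\big(F^p_{\mathcal M,i}(L^p(\mathcal N\otimes\mathcal M))\big)_{i\ge0}$ are Schauder decompositions of $L^p(\mathcal N\otimes\mathcal M)$, i.e. sequences of closed subspaces $X_s$ such that every $x$ has a unique expansion $x=\sum_{s=0}^\infty x_s$ (norm convergent partial sums) with $x_s\in X_s$. Then the vectors $i^p(u_i\otimes v_j)$, listed in the shell enumeration in which $(i,j)$ has the number $j^2+i$ if $i\le j$ and $(i+1)^2-j-1$ if $i>j$, form a Schauder basis of $L^p(\mathcal N\otimes\mathcal M)$. -/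

import Mathlib

open Filter Set
open scoped Topology ENNReal TensorProduct InnerProductSpace ZeroAtInfty ComplexOrder

noncomputable section

namespace NCLp

/-! ### Complex interpolation of a couple `A₀ ↪ A₁` -/

section Interpolation

variable {A₀ A₁ : Type*} [NormedAddCommGroup A₀] [NormedSpace ℂ A₀]
  [NormedAddCommGroup A₁] [NormedSpace ℂ A₁]

/-- Calderón's class of functions on the strip `0 ≤ Re z ≤ 1` for the couple `(A₀, A₁)`, where `A₀`
is included in `A₁` by `ι` (so that `A₀ + A₁ = A₁`): `f` is bounded and continuous on the closed
strip and analytic inside, `t ↦ f (i t)` is a continuous function `g` into `A₀` vanishing at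
infinity, and `t ↦ f (1 + i t)` is a continuous function `h` into `A₁` vanishing at infinity. -/
structure IsCalderon (ι : A₀ →L[ℂ] A₁) (f : ℂ → A₁) (g : C₀(ℝ, A₀)) (h : C₀(ℝ, A₁)) : Prop where
  continuousOn : ContinuousOn f (Complex.re ⁻¹' Icc 0 1)
  bounded : ∃ C : ℝ, ∀ z ∈ Complex.re ⁻¹' Icc 0 1, ‖f z‖ ≤ C
  differentiableOn : DifferentiableOn ℂ f (Complex.re ⁻¹' Ioo 0 1)
  left_eq : ∀ t : ℝ, f (t * Complex.I) = ι (g t)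
  right_eq : ∀ t : ℝ, f (1 + t * Complex.I) = h t

variable {ι : A₀ →L[ℂ] A₁}

theorem IsCalderon.zero : IsCalderon ι 0 0 0 where
  continuousOn := continuousOn_const
  bounded := ⟨0, by simp⟩
  differentiableOn := differentiableOn_const _
  left_eq := by simp
  right_eq := by simp

theorem IsCalderon.add {f f' : ℂ → A₁} {g g' : C₀(ℝ, A₀)} {h h' : C₀(ℝ, A₁)}
    (H : IsCalderon ι f g h) (H' : IsCalderon ι f' g' h') :
    IsCalderon ι (f + f') (g + g') (h + h') where
  continuousOn := H.continuousOn.add H'.continuousOn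
  bounded := by
    obtain ⟨C, hC⟩ := H.bounded
    obtain ⟨C', hC'⟩ := H'.bounded
    exact ⟨C + C', fun z hz => (norm_add_le _ _).trans (add_le_add (hC z hz) (hC' z hz))⟩
  differentiableOn := H.differentiableOn.add H'.differentiableOn
  left_eq t := by simp [H.left_eq, H'.left_eq]
  right_eq t := by simp [H.right_eq, H'.right_eq]

theorem IsCalderon.smul (c : ℂ) {f : ℂ → A₁} {g : C₀(ℝ, A₀)} {h : C₀(ℝ, A₁)}
    (H : IsCalderon ι f g h) : IsCalderon ι (c • f) (c • g) (c • h) where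
  continuousOn := H.continuousOn.const_smul c
  bounded := by
    obtain ⟨C, hC⟩ := H.bounded
    refine ⟨‖c‖ * C, fun z hz => ?_⟩
    rw [Pi.smul_apply, norm_smul]
    exact mul_le_mul_of_nonneg_left (hC z hz) (norm_nonneg c)
  differentiableOn := H.differentiableOn.const_smul c
  left_eq t := by simp [H.left_eq]
  right_eq t := by simp [H.right_eq]

theorem C₀_norm_apply_le {E : Type*} [NormedAddCommGroup E] (g : C₀(ℝ, E)) (t : ℝ) :
    ‖g t‖ ≤ ‖g‖ := by
  rw [← ZeroAtInftyContinuousMap.norm_toBCF_eq_norm]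
  exact g.toBCF.norm_coe_le_norm t

/-- Maximum principle on the strip. -/
theorem IsCalderon.norm_le {f : ℂ → A₁} {g : C₀(ℝ, A₀)} {h : C₀(ℝ, A₁)}
    (H : IsCalderon ι f g h) {z : ℂ} (hz : z ∈ Complex.re ⁻¹' Icc 0 1) :
    ‖f z‖ ≤ max 1 ‖ι‖ * max ‖g‖ ‖h‖ := by
  have hcl : closure (Complex.re ⁻¹' Ioo 0 1) = Complex.re ⁻¹' Icc (0 : ℝ) 1 := by
    rw [Complex.closure_preimage_re, closure_Ioo zero_ne_one]
  have hne : (0 : ℝ) ≤ max ‖g‖ ‖h‖ := (norm_nonneg g).trans (le_max_left _ _)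
  refine PhragmenLindelof.vertical_strip (a := 0) (b := 1) (f := f)
    ⟨H.differentiableOn, by rw [hcl]; exact H.continuousOn⟩ ?_ ?_ ?_ hz.1 hz.2
  · obtain ⟨C, hC⟩ := H.bounded
    refine ⟨0, by simpa using Real.pi_pos, 0, ?_⟩
    refine Asymptotics.IsBigO.of_bound C ?_
    refine eventually_inf_principal.2 (Eventually.of_forall fun w hw => ?_)
    simpa using hC w ⟨hw.1.le, hw.2.le⟩
  · intro w hw
    have e : w = (w.im : ℂ) * Complex.I := by
      apply Complex.ext <;> simp [hw]
    rw [e, H.left_eq]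
    calc ‖ι (g w.im)‖ ≤ ‖ι‖ * ‖g w.im‖ := ι.le_opNorm _
      _ ≤ max 1 ‖ι‖ * max ‖g‖ ‖h‖ := by
        gcongr
        · exact le_max_right _ _
        · exact (C₀_norm_apply_le g _).trans (le_max_left _ _)
  · intro w hw
    have e : w = 1 + (w.im : ℂ) * Complex.I := by
      apply Complex.ext <;> simp [hw]
    rw [e, H.right_eq]
    calc ‖h w.im‖ ≤ max ‖g‖ ‖h‖ := (C₀_norm_apply_le h _).trans (le_max_right _ _)
      _ ≤ max 1 ‖ι‖ * max ‖g‖ ‖h‖ := le_mul_of_one_le_left hne (le_max_left _ _)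

/-- The underlying vector space of the complex interpolation space `(A₀, A₁)_[θ]`, as a subspace
of `A₁`: the values `f θ` of the functions of Calderón's class. -/
def interpSubmodule (ι : A₀ →L[ℂ] A₁) (θ : unitInterval) : Submodule ℂ A₁ where
  carrier := {a | ∃ f g h, IsCalderon ι f g h ∧ f ((θ : ℝ) : ℂ) = a}
  zero_mem' := ⟨0, 0, 0, IsCalderon.zero, rfl⟩
  add_mem' := by
    rintro _ _ ⟨f, g, h, H, rfl⟩ ⟨f', g', h', H', rfl⟩
    exact ⟨_, _, _, H.add H', rfl⟩
  smul_mem' := by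
    rintro c _ ⟨f, g, h, H, rfl⟩
    exact ⟨_, _, _, H.smul c, rfl⟩

/-- The complex interpolation space `(A₀, A₁)_[θ]`, `0 ≤ θ ≤ 1`; its norm is the interpolation
norm below, not the norm of `A₁`. -/
def Interp (ι : A₀ →L[ℂ] A₁) (θ : unitInterval) : Type _ := ↥(interpSubmodule ι θ)

namespace Interp

variable {θ : unitInterval}

instance : AddCommGroup (Interp ι θ) := inferInstanceAs (AddCommGroup ↥(interpSubmodule ι θ))

instance : Module ℂ (Interp ι θ) := inferInstanceAs (Module ℂ ↥(interpSubmodule ι θ))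

variable (ι θ) in
/-- The inclusion of `(A₀, A₁)_[θ]` in `A₁`. -/
def val : Interp ι θ →ₗ[ℂ] A₁ := (interpSubmodule ι θ).subtype

theorem val_injective : Function.Injective (val ι θ) := Subtype.val_injective

/-- The values `max (sup ‖f (i t)‖) (sup ‖f (1 + i t)‖)` over the `f` with `f θ = a`. -/
def normSet (a : Interp ι θ) : Set ℝ :=
  {C | ∃ f g h, IsCalderon ι f g h ∧ f ((θ : ℝ) : ℂ) = val ι θ a ∧ C = max ‖g‖ ‖h‖}

/-- The interpolation norm. -/
instance : Norm (Interp ι θ) := ⟨fun a => sInf (normSet a)⟩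

theorem norm_def (a : Interp ι θ) : ‖a‖ = sInf (normSet a) := rfl

theorem normSet_nonempty (a : Interp ι θ) : (normSet a).Nonempty := by
  obtain ⟨f, g, h, H, e⟩ := a.2
  exact ⟨_, f, g, h, H, e, rfl⟩

theorem normSet_nonneg (a : Interp ι θ) : ∀ C ∈ normSet a, 0 ≤ C := by
  rintro _ ⟨f, g, h, -, -, rfl⟩
  exact (norm_nonneg g).trans (le_max_left _ _)

theorem normSet_bddBelow (a : Interp ι θ) : BddBelow (normSet a) := ⟨0, normSet_nonneg a⟩

theorem norm_le_of {a : Interp ι θ} {f : ℂ → A₁} {g : C₀(ℝ, A₀)} {h : C₀(ℝ, A₁)}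
    (H : IsCalderon ι f g h) (e : f ((θ : ℝ) : ℂ) = val ι θ a) : ‖a‖ ≤ max ‖g‖ ‖h‖ :=
  csInf_le (normSet_bddBelow a) ⟨f, g, h, H, e, rfl⟩

theorem exists_of_lt {a : Interp ι θ} {C : ℝ} (hC : ‖a‖ < C) :
    ∃ f g h, IsCalderon ι f g h ∧ f ((θ : ℝ) : ℂ) = val ι θ a ∧ max ‖g‖ ‖h‖ < C := by
  obtain ⟨_, ⟨f, g, h, H, e, rfl⟩, hlt⟩ := exists_lt_of_csInf_lt (normSet_nonempty a) hC
  exact ⟨f, g, h, H, e, hlt⟩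

theorem norm_val_le (a : Interp ι θ) : ‖val ι θ a‖ ≤ max 1 ‖ι‖ * ‖a‖ := by
  have hpos : 0 < max 1 ‖ι‖ := lt_max_of_lt_left one_pos
  rw [← div_le_iff₀' hpos]
  refine le_csInf (normSet_nonempty a) ?_
  rintro _ ⟨f, g, h, H, e, rfl⟩
  rw [div_le_iff₀' hpos, ← e]
  exact H.norm_le (by simp)

theorem norm_smul_le' (c : ℂ) (a : Interp ι θ) : ‖c • a‖ ≤ ‖c‖ * ‖a‖ := by
  refine le_of_forall_pos_lt_add fun ε hε => ?_
  obtain ⟨f, g, h, H, e, hlt⟩ := exists_of_lt (a := a) (C := ‖a‖ + ε / (‖c‖ + 1))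
    (lt_add_of_pos_right _ (by positivity))
  refine (norm_le_of (H.smul c) (by simp [e])).trans_lt ?_
  rw [norm_smul, norm_smul, ← mul_max_of_nonneg _ _ (norm_nonneg c)]
  have h1 : ‖c‖ * (ε / (‖c‖ + 1)) < ε := by
    rw [← mul_div_assoc, div_lt_iff₀ (by positivity)]
    nlinarith [norm_nonneg c]
  have h2 := mul_le_mul_of_nonneg_left hlt.le (norm_nonneg c)
  linarith [mul_add ‖c‖ ‖a‖ (ε / (‖c‖ + 1))]

theorem core : NormedSpace.Core ℂ (Interp ι θ) where
  norm_nonneg a := Real.sInf_nonneg (normSet_nonneg a)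
  norm_smul c a := by
    refine le_antisymm (norm_smul_le' c a) ?_
    rcases eq_or_ne c 0 with rfl | hc
    · rw [norm_zero, zero_mul]
      exact Real.sInf_nonneg (normSet_nonneg _)
    · have := norm_smul_le' c⁻¹ (c • a)
      rw [smul_smul, inv_mul_cancel₀ hc, one_smul, norm_inv] at this
      rwa [← inv_mul_le_iff₀ (by positivity), inv_inv] at this
  norm_triangle a b := by
    refine le_of_forall_pos_lt_add fun ε hε => ?_
    obtain ⟨f, g, h, H, e, hlt⟩ := exists_of_lt (lt_add_of_pos_right ‖a‖ (half_pos hε))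
    obtain ⟨f', g', h', H', e', hlt'⟩ := exists_of_lt (lt_add_of_pos_right ‖b‖ (half_pos hε))
    refine (norm_le_of (H.add H') (by simp [e, e'])).trans_lt ?_
    refine (max_le_max (norm_add_le g g') (norm_add_le h h')).trans_lt ?_
    refine max_lt ?_ ?_
    · linarith [le_max_left ‖g‖ ‖h‖, le_max_left ‖g'‖ ‖h'‖]
    · linarith [le_max_right ‖g‖ ‖h‖, le_max_right ‖g'‖ ‖h'‖]
  norm_eq_zero_iff a := by
    constructor
    · intro h0
      apply val_injective
      rw [map_zero, ← norm_le_zero_iff]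
      simpa [h0] using norm_val_le a
    · rintro rfl
      refine le_antisymm ?_ (Real.sInf_nonneg (normSet_nonneg _))
      simpa using norm_le_of (a := (0 : Interp ι θ)) IsCalderon.zero (by simp)

instance : NormedAddCommGroup (Interp ι θ) := NormedAddCommGroup.ofCore core

instance : NormedSpace ℂ (Interp ι θ) := NormedSpace.ofCore core

/-- A Gaussian times a constant vector, in `C₀(ℝ, E)`. -/
def gauss {E : Type*} [NormedAddCommGroup E] [NormedSpace ℂ E] (s : ℂ) (a : E) : C₀(ℝ, E) where
  toFun t := Complex.exp ((s + t * Complex.I) ^ 2) • a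
  continuous_toFun := by fun_prop
  zero_at_infty' := by
    have h1 : Tendsto (fun t : ℝ => Complex.exp ((s + t * Complex.I) ^ 2)) (cocompact ℝ) (𝓝 0) := by
      rw [tendsto_zero_iff_norm_tendsto_zero]
      have e : ∀ t : ℝ, ‖Complex.exp ((s + t * Complex.I) ^ 2)‖
          = Real.exp (-((s.im + t) ^ 2) + s.re ^ 2) := by
        intro t
        rw [Complex.norm_exp]
        congr 1
        simp [pow_two]
        ring
      simp_rw [e]
      refine Real.tendsto_exp_atBot.comp (tendsto_atBot_add_const_right _ _ ?_)
      refine tendsto_neg_atTop_atBot.comp ?_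
      have h2 : Tendsto (fun t : ℝ => ‖s.im + t‖) (cocompact ℝ) atTop :=
        tendsto_norm_cocompact_atTop.comp
          (Homeomorph.addLeft s.im).isClosedEmbedding.tendsto_cocompact
      have h3 := (tendsto_pow_atTop (two_ne_zero)).comp h2
      refine h3.congr fun t => ?_
      simp
    simpa using h1.smul_const a

theorem incl_mem (a : A₀) : ι a ∈ interpSubmodule ι θ := by
  set s : ℂ := Complex.exp (-((θ : ℝ) : ℂ) ^ 2)
  refine ⟨fun z => Complex.exp (z ^ 2) • ι (s • a), gauss 0 (s • a), gauss 1 (ι (s • a)),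
    ⟨?_, ?_, ?_, ?_, ?_⟩, ?_⟩
  · exact Continuous.continuousOn (by fun_prop)
  · refine ⟨Real.exp 1 * ‖ι (s • a)‖, fun z hz => ?_⟩
    rw [norm_smul, Complex.norm_exp]
    gcongr
    have h0 : 0 ≤ z.re := hz.1
    have h1 : z.re ≤ 1 := hz.2
    simp only [pow_two, Complex.mul_re]
    nlinarith [mul_self_nonneg z.im]
  · exact Differentiable.differentiableOn (by fun_prop)
  · intro t; simp [gauss]
  · intro t; simp [gauss]
  · simp only [s, map_smul, smul_smul, ← Complex.exp_add]
    simp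

variable (ι θ) in
/-- The embedding of `A₀` in `(A₀, A₁)_[θ]`. -/
def incl : A₀ →ₗ[ℂ] Interp ι θ := (ι : A₀ →ₗ[ℂ] A₁).codRestrict (interpSubmodule ι θ) incl_mem

theorem val_incl (a : A₀) : val ι θ (incl ι θ a) = ι a := rfl

variable {B₀ B₁ : Type*} [NormedAddCommGroup B₀] [NormedSpace ℂ B₀]
  [NormedAddCommGroup B₁] [NormedSpace ℂ B₁] {κ : B₀ →L[ℂ] B₁}

/-- Post-composition with a bounded operator on `C₀(ℝ, E)`. -/
def compC₀ {E F : Type*} [NormedAddCommGroup E] [NormedSpace ℂ E] [NormedAddCommGroup F]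
    [NormedSpace ℂ F] (T : E →L[ℂ] F) (g : C₀(ℝ, E)) : C₀(ℝ, F) where
  toFun t := T (g t)
  continuous_toFun := T.continuous.comp g.continuous
  zero_at_infty' := by
    have h := (T.continuous.tendsto 0).comp g.zero_at_infty'
    rwa [map_zero] at h

theorem norm_compC₀_le {E F : Type*} [NormedAddCommGroup E] [NormedSpace ℂ E]
    [NormedAddCommGroup F] [NormedSpace ℂ F] (T : E →L[ℂ] F) (g : C₀(ℝ, E)) :
    ‖compC₀ T g‖ ≤ ‖T‖ * ‖g‖ := by
  rw [← ZeroAtInftyContinuousMap.norm_toBCF_eq_norm]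
  refine (BoundedContinuousFunction.norm_le (by positivity)).2 fun t => ?_
  exact (T.le_opNorm _).trans (mul_le_mul_of_nonneg_left (C₀_norm_apply_le g t) (norm_nonneg T))

theorem isCalderon_comp {T₀ : A₀ →L[ℂ] B₀} {T₁ : A₁ →L[ℂ] B₁} (hT : ∀ a, T₁ (ι a) = κ (T₀ a))
    {f : ℂ → A₁} {g : C₀(ℝ, A₀)} {h : C₀(ℝ, A₁)} (H : IsCalderon ι f g h) :
    IsCalderon κ (fun z => T₁ (f z)) (compC₀ T₀ g) (compC₀ T₁ h) where
  continuousOn := T₁.continuous.comp_continuousOn H.continuousOn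
  bounded := by
    obtain ⟨C, hC⟩ := H.bounded
    exact ⟨‖T₁‖ * C, fun z hz => (T₁.le_opNorm _).trans
      (mul_le_mul_of_nonneg_left (hC z hz) (norm_nonneg T₁))⟩
  differentiableOn := T₁.differentiable.comp_differentiableOn H.differentiableOn
  left_eq t := by simp [H.left_eq, hT, compC₀]
  right_eq t := by simp [H.right_eq, compC₀]

/-- The interpolated map `(A₀, A₁)_[θ] → (B₀, B₁)_[θ]` of a morphism `(T₀, T₁)` of couples; it is
the restriction of `T₁`. -/
def map (T₀ : A₀ →L[ℂ] B₀) (T₁ : A₁ →L[ℂ] B₁) (hT : ∀ a, T₁ (ι a) = κ (T₀ a))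
    (θ : unitInterval) : Interp ι θ →L[ℂ] Interp κ θ :=
  LinearMap.mkContinuous
    (((T₁ : A₁ →ₗ[ℂ] B₁) ∘ₗ val ι θ).codRestrict (interpSubmodule κ θ) (by
      rintro ⟨_, f, g, h, H, rfl⟩
      exact ⟨_, _, _, isCalderon_comp hT H, rfl⟩) : Interp ι θ →ₗ[ℂ] Interp κ θ)
    (max ‖T₀‖ ‖T₁‖) (by
      intro a
      rcases (le_max_of_le_left (norm_nonneg T₀) : 0 ≤ max ‖T₀‖ ‖T₁‖).eq_or_lt with h0 | hpos
      · have hT0 : ‖T₀‖ ≤ 0 := h0 ▸ le_max_left _ _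
        have hT1 : ‖T₁‖ ≤ 0 := h0 ▸ le_max_right _ _
        obtain ⟨f, g, h, H, e⟩ := a.2
        refine (norm_le_of (isCalderon_comp hT H) (congrArg T₁ e)).trans ?_
        rw [← h0, zero_mul]
        exact max_le
          ((norm_compC₀_le _ _).trans (mul_nonpos_of_nonpos_of_nonneg hT0 (norm_nonneg _)))
          ((norm_compC₀_le _ _).trans (mul_nonpos_of_nonpos_of_nonneg hT1 (norm_nonneg _)))
      · rw [← div_le_iff₀' hpos]
        refine le_csInf (normSet_nonempty a) ?_
        rintro _ ⟨f, g, h, H, e, rfl⟩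
        rw [div_le_iff₀' hpos]
        refine (norm_le_of (isCalderon_comp hT H) (congrArg T₁ e)).trans ?_
        refine max_le ((norm_compC₀_le _ _).trans ?_) ((norm_compC₀_le _ _).trans ?_)
        · gcongr <;> exact le_max_left _ _
        · gcongr <;> exact le_max_right _ _)

theorem val_map (T₀ : A₀ →L[ℂ] B₀) (T₁ : A₁ →L[ℂ] B₁) (hT : ∀ a, T₁ (ι a) = κ (T₀ a))
    (a : Interp ι θ) : val κ θ (map T₀ T₁ hT θ a) = T₁ (val ι θ a) := rfl

end Interp

end Interpolation

/-! ### Von Neumann algebras, preduals, and non-commutative `L^p`-spaces -/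

section VonNeumann

variable {H : Type*} [NormedAddCommGroup H] [InnerProductSpace ℂ H] [CompleteSpace H]

/-- The elements of a von Neumann algebra, with the operator norm. -/
def El (N : VonNeumannAlgebra H) : Type _ := ↥N.toStarSubalgebra

instance (N : VonNeumannAlgebra H) : NormedRing (El N) :=
  inferInstanceAs (NormedRing ↥N.toStarSubalgebra)

instance (N : VonNeumannAlgebra H) : NormedAlgebra ℂ (El N) :=
  inferInstanceAs (NormedAlgebra ℂ ↥N.toStarSubalgebra)

instance (N : VonNeumannAlgebra H) : StarRing (El N) :=
  inferInstanceAs (StarRing ↥N.toStarSubalgebra)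

instance (N : VonNeumannAlgebra H) : NormedAddCommGroup (El N) := inferInstance

instance (N : VonNeumannAlgebra H) : NormedSpace ℂ (El N) := inferInstance

namespace El

variable {N : VonNeumannAlgebra H}

/-- The operator underlying an element of `N`. -/
def op (x : El N) : H →L[ℂ] H := Subtype.val x

/-- An operator that lies in `N`, as an element of `N`. -/
def mk (x : H →L[ℂ] H) (hx : x ∈ N) : El N := ⟨x, hx⟩

theorem op_mem (x : El N) : x.op ∈ N := Subtype.property x

theorem ext {x y : El N} (h : x.op = y.op) : x = y := Subtype.ext h

@[simp] theorem op_mk (x : H →L[ℂ] H) (hx : x ∈ N) : (mk x hx).op = x := rfl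
@[simp] theorem op_add (x y : El N) : (x + y).op = x.op + y.op := rfl
@[simp] theorem op_smul (c : ℂ) (x : El N) : (c • x).op = c • x.op := rfl
@[simp] theorem op_mul (x y : El N) : (x * y).op = x.op * y.op := rfl
@[simp] theorem op_one : (1 : El N).op = 1 := rfl
@[simp] theorem op_star (x : El N) : (star x).op = star x.op := rfl

theorem norm_op (x : El N) : ‖x.op‖ = ‖x‖ := rfl

variable (N) in
/-- The isometric inclusion of `N` in the bounded operators. -/
def opL : El N →L[ℂ] (H →L[ℂ] H) := N.toStarSubalgebra.toSubalgebra.toSubmodule.subtypeL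

end El

/-- The functional `x ↦ ⟨ξ, x η⟩` on `N`. -/
def vecFunctional (N : VonNeumannAlgebra H) (ξ η : H) : StrongDual ℂ (El N) :=
  (innerSL ℂ ξ) ∘L (ContinuousLinearMap.apply ℂ H η) ∘L
    El.opL N

@[simp]
theorem vecFunctional_apply (N : VonNeumannAlgebra H) (ξ η : H) (x : El N) :
    vecFunctional N ξ η x = ⟪ξ, x.op η⟫_ℂ := rfl

/-- The predual `N_*`: the normal functionals on `N`, that is, the norm closure in the dual of `N`
of the linear span of the vector functionals `x ↦ ⟨ξ, x η⟩`. -/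
def predual (N : VonNeumannAlgebra H) : Submodule ℂ (StrongDual ℂ (El N)) :=
  (Submodule.span ℂ (range fun p : H × H => vecFunctional N p.1 p.2)).topologicalClosure

theorem vecFunctional_mem (N : VonNeumannAlgebra H) (ξ η : H) : vecFunctional N ξ η ∈ predual N :=
  Submodule.le_topologicalClosure _ (Submodule.subset_span ⟨(ξ, η), rfl⟩)

/-- A closed condition on normal functionals can be checked on vector functionals. -/
theorem predual_induction {N : VonNeumannAlgebra H} {V : Submodule ℂ (StrongDual ℂ (El N))}
    (hV : IsClosed (V : Set (StrongDual ℂ (El N)))) (h : ∀ ξ η, vecFunctional N ξ η ∈ V)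
    {ω : StrongDual ℂ (El N)} (hω : ω ∈ predual N) : ω ∈ V := by
  refine Submodule.topologicalClosure_minimal _ (Submodule.span_le.2 ?_) hV hω
  rintro _ ⟨p, rfl⟩
  exact h _ _

theorem predual_isClosed (N : VonNeumannAlgebra H) :
    IsClosed (predual N : Set (StrongDual ℂ (El N))) :=
  Submodule.isClosed_topologicalClosure _

/-- The predual of `N` as a Banach space. -/
def Predual (N : VonNeumannAlgebra H) : Type _ := ↥(predual N)

instance (N : VonNeumannAlgebra H) : NormedAddCommGroup (Predual N) :=
  inferInstanceAs (NormedAddCommGroup ↥(predual N))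

instance (N : VonNeumannAlgebra H) : NormedSpace ℂ (Predual N) :=
  inferInstanceAs (NormedSpace ℂ ↥(predual N))

namespace Predual

variable {N : VonNeumannAlgebra H}

variable (N) in
/-- The inclusion of the predual in the dual of `N`. -/
def dualL : Predual N →L[ℂ] StrongDual ℂ (El N) := (predual N).subtypeL

/-- The functional underlying an element of the predual. -/
def toDual (ω : Predual N) : StrongDual ℂ (El N) := dualL N ω

instance : CoeFun (Predual N) fun _ => El N → ℂ := ⟨fun ω => ω.toDual⟩

theorem toDual_mem (ω : Predual N) : ω.toDual ∈ predual N := Subtype.property ω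

theorem ext {ω ω' : Predual N} (h : ∀ x, ω x = ω' x) : ω = ω' :=
  Subtype.ext (ContinuousLinearMap.ext h)

@[simp] theorem add_apply (ω ω' : Predual N) (x : El N) : (ω + ω') x = ω x + ω' x := rfl
@[simp] theorem smul_apply (c : ℂ) (ω : Predual N) (x : El N) : (c • ω) x = c * ω x := rfl

theorem norm_toDual (ω : Predual N) : ‖ω.toDual‖ = ‖ω‖ := rfl

end Predual

variable {L : Type*} [NormedAddCommGroup L] [InnerProductSpace ℂ L] [CompleteSpace L]

/-- The map `ω ↦ ω ∘ R` of preduals, for a bounded normal linear map `R : A → B`. -/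
def predualMap {A : VonNeumannAlgebra H} {B : VonNeumannAlgebra L} (R : El A →L[ℂ] El B)
    (hR : ∀ ξ η, vecFunctional B ξ η ∘L R ∈ predual A) : Predual B →L[ℂ] Predual A :=
  ((ContinuousLinearMap.precomp ℂ R) ∘L Predual.dualL B).codRestrict (predual A) (by
    intro ω
    let T : StrongDual ℂ (El B) →L[ℂ] StrongDual ℂ (El A) := ContinuousLinearMap.precomp ℂ R
    let V : Submodule ℂ (StrongDual ℂ (El B)) := (predual A).comap T.toLinearMap
    have hV : IsClosed (V : Set (StrongDual ℂ (El B))) :=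
      (predual_isClosed A).preimage T.continuous
    exact predual_induction hV hR ω.toDual_mem)

@[simp]
theorem predualMap_apply {A : VonNeumannAlgebra H} {B : VonNeumannAlgebra L} (R : El A →L[ℂ] El B)
    (hR : ∀ ξ η, vecFunctional B ξ η ∘L R ∈ predual A) (ω : Predual B) (x : El A) :
    predualMap R hR ω x = ω (R x) := rfl

/-- Left multiplication `y ↦ x y` on `N`. -/
def lmul (N : VonNeumannAlgebra H) (x : El N) : El N →L[ℂ] El N := ContinuousLinearMap.mul ℂ (El N) x

/-- Left multiplication on the predual: `(x ω)(y) = ω (y x)`. -/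
def lmulPredual (N : VonNeumannAlgebra H) (x : El N) : Predual N →L[ℂ] Predual N :=
  predualMap ((ContinuousLinearMap.mul ℂ (El N)).flip x) fun ξ η => by
    exact vecFunctional_mem N ξ (x.op η)

@[simp]
theorem lmulPredual_apply (N : VonNeumannAlgebra H) (x y : El N) (ω : Predual N) :
    lmulPredual N x ω y = ω (y * x) := rfl

/-- The left injection `x ↦ x ω` of `N` in `N_*`. -/
def leftInj (N : VonNeumannAlgebra H) (ω : Predual N) : El N →L[ℂ] Predual N :=
  LinearMap.mkContinuous
    { toFun := fun x => lmulPredual N x ω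
      map_add' := fun x y => Predual.ext fun z => by simp [mul_add]
      map_smul' := fun c x => Predual.ext fun z => by simp }
    ‖ω‖ (fun x => ContinuousLinearMap.opNorm_le_bound _ (by positivity) fun y => by
      calc ‖ω (y * x)‖ ≤ ‖ω‖ * ‖y * x‖ :=
            ω.toDual.le_opNorm _
        _ ≤ ‖ω‖ * (‖y‖ * ‖x‖) := by gcongr; exact norm_mul_le _ _
        _ = ‖ω‖ * ‖x‖ * ‖y‖ := by ring)

@[simp]
theorem leftInj_apply (N : VonNeumannAlgebra H) (ω : Predual N) (x y : El N) :
    leftInj N ω x y = ω (y * x) := rfl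

/-- Faithful normal states. Normality is membership in the predual. -/
structure IsFaithfulState {N : VonNeumannAlgebra H} (ω : Predual N) : Prop where
  nonneg : ∀ x : El N, 0 ≤ ω (star x * x)
  map_one : ω 1 = 1
  faithful : ∀ x : El N, ω (star x * x) = 0 → x = 0

/-- The interpolation parameter `1 / p`, for `1 ≤ p ≤ ∞`. -/
def param (p : ℝ≥0∞) [hp : Fact (1 ≤ p)] : unitInterval :=
  ⟨(p⁻¹).toReal, ENNReal.toReal_nonneg, by
    have h : p⁻¹ ≤ 1 := ENNReal.inv_le_one.2 hp.out
    simpa using ENNReal.toReal_mono ENNReal.one_ne_top h⟩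

/-- The non-commutative space `L^p(N) = (N, N_*)_[1/p]` with respect to the left injection
`x ↦ x ω`. -/
abbrev Lp (N : VonNeumannAlgebra H) (ω : Predual N) (p : ℝ≥0∞) [Fact (1 ≤ p)] : Type _ :=
  Interp (A₀ := El N) (A₁ := Predual N) (leftInj N ω) (param p)

/-- The embedding `i^p : N → L^p(N)`. -/
def toLp (N : VonNeumannAlgebra H) (ω : Predual N) (p : ℝ≥0∞) [Fact (1 ≤ p)] :
    El N →ₗ[ℂ] Lp N ω p :=
  Interp.incl (A₀ := El N) (A₁ := Predual N) (leftInj N ω) (param p)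

/-- The von Neumann algebra generated by a set of operators: the double commutant of its
self-adjoint hull. -/
def vnGen (S : Set (H →L[ℂ] H)) : VonNeumannAlgebra H where
  toStarSubalgebra := StarSubalgebra.centralizer ℂ (StarSubalgebra.centralizer ℂ S : Set (H →L[ℂ] H))
  centralizer_centralizer' := by simp

theorem subset_vnGen (S : Set (H →L[ℂ] H)) : S ⊆ (vnGen S).toStarSubalgebra := by
  intro x hx
  change x ∈ StarSubalgebra.centralizer ℂ (StarSubalgebra.centralizer ℂ S : Set (H →L[ℂ] H))
  rw [StarSubalgebra.mem_centralizer_iff]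
  intro g hg
  rw [SetLike.mem_coe, StarSubalgebra.mem_centralizer_iff] at hg
  refine ⟨((hg x hx).1).symm, ?_⟩
  have h := congrArg star (hg x hx).2
  simpa using h

theorem commute_of_mem_vnGen {S : Set (H →L[ℂ] H)} {x z : H →L[ℂ] H}
    (hx : x ∈ (vnGen S).toStarSubalgebra)
    (hz : ∀ s ∈ S, s * z = z * s) (hz' : ∀ s ∈ S, s * star z = star z * s) : z * x = x * z := by
  change x ∈ StarSubalgebra.centralizer ℂ (StarSubalgebra.centralizer ℂ S : Set (H →L[ℂ] H)) at hx
  rw [StarSubalgebra.mem_centralizer_iff] at hx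
  refine (hx z ?_).1
  rw [SetLike.mem_coe, StarSubalgebra.mem_centralizer_iff]
  refine fun s hs => ⟨hz s hs, ?_⟩
  have h := congrArg star (hz' s hs)
  simpa using h.symm

end VonNeumann

/-! ### Tensor products of von Neumann algebras -/

section Tensor

set_option linter.unusedSectionVars false

variable {H K L : Type*} [NormedAddCommGroup H] [InnerProductSpace ℂ H] [CompleteSpace H]
  [NormedAddCommGroup K] [InnerProductSpace ℂ K] [CompleteSpace K]
  [NormedAddCommGroup L] [InnerProductSpace ℂ L] [CompleteSpace L]

variable (H K) in
/-- The Hilbert space tensor product. -/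
def HTensor : Type _ := UniformSpace.Completion (H ⊗[ℂ] K)

instance : NormedAddCommGroup (HTensor H K) :=
  inferInstanceAs (NormedAddCommGroup (UniformSpace.Completion (H ⊗[ℂ] K)))

instance : InnerProductSpace ℂ (HTensor H K) :=
  inferInstanceAs (InnerProductSpace ℂ (UniformSpace.Completion (H ⊗[ℂ] K)))

instance : CompleteSpace (HTensor H K) :=
  inferInstanceAs (CompleteSpace (UniformSpace.Completion (H ⊗[ℂ] K)))

variable (H K) in
/-- The canonical map from the algebraic to the Hilbert space tensor product. -/
def HTensor.ofAlg : H ⊗[ℂ] K →L[ℂ] HTensor H K :=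
  (UniformSpace.Completion.toComplL : H ⊗[ℂ] K →L[ℂ] UniformSpace.Completion (H ⊗[ℂ] K))

variable (H K) in
/-- The bilinear map `(h, k) ↦ h ⊗ k`. -/
def tmulL : H →L[ℂ] K →L[ℂ] HTensor H K :=
  (ContinuousLinearMap.compL ℂ K (H ⊗[ℂ] K) (HTensor H K) (HTensor.ofAlg H K)) ∘L
    TensorProduct.mkL ℂ H K

theorem tmulL_apply (h : H) (k : K) :
    tmulL H K h k = HTensor.ofAlg H K (h ⊗ₜ[ℂ] k) := rfl

theorem inner_tmulL (h h' : H) (k k' : K) :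
    ⟪tmulL H K h k, tmulL H K h' k'⟫_ℂ = ⟪h, h'⟫_ℂ * ⟪k, k'⟫_ℂ := by
  exact (UniformSpace.Completion.inner_coe _ _).trans (TensorProduct.inner_tmul _ _ _ _ _)

/-- A closed subspace containing the elementary tensors is everything. -/
theorem htensor_induction {V : Submodule ℂ (HTensor H K)} (hV : IsClosed (V : Set (HTensor H K)))
    (h : ∀ a b, tmulL H K a b ∈ V) (ξ : HTensor H K) : ξ ∈ V := by
  refine UniformSpace.Completion.induction_on (p := fun ξ : HTensor H K => ξ ∈ V) ξ hV fun a => ?_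
  change HTensor.ofAlg H K a ∈ V
  induction a using TensorProduct.induction_on with
  | zero => rw [map_zero]; exact V.zero_mem
  | tmul a b => exact h a b
  | add a b ha hb => rw [map_add]; exact V.add_mem ha hb

theorem htensor_ext {S T : HTensor H K →L[ℂ] HTensor H K}
    (h : ∀ a b, S (tmulL H K a b) = T (tmulL H K a b)) : S = T := by
  ext ξ
  exact htensor_induction (V := LinearMap.eqLocus S.toLinearMap T.toLinearMap)
    (isClosed_eq S.continuous T.continuous) h ξ

/-- The operator `x ⊗ y` on the Hilbert space tensor product. -/
def opTensor (x : H →L[ℂ] H) (y : K →L[ℂ] K) : HTensor H K →L[ℂ] HTensor H K :=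
  (TensorProduct.mapL x y).completion

@[simp]
theorem opTensor_tmulL (x : H →L[ℂ] H) (y : K →L[ℂ] K) (h : H) (k : K) :
    opTensor x y (tmulL H K h k) = tmulL H K (x h) (y k) := by
  exact ContinuousLinearMap.completion_apply_coe (TensorProduct.mapL x y) (h ⊗ₜ[ℂ] k)

theorem norm_opTensor_le (x : H →L[ℂ] H) (y : K →L[ℂ] K) : ‖opTensor x y‖ ≤ ‖x‖ * ‖y‖ := by
  refine ContinuousLinearMap.opNorm_le_bound _ (by positivity) fun ξ => ?_
  refine UniformSpace.Completion.induction_on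
    (p := fun ξ : HTensor H K => ‖opTensor x y ξ‖ ≤ ‖x‖ * ‖y‖ * ‖ξ‖) ξ
    (isClosed_le (opTensor x y).continuous.norm (continuous_const.mul continuous_norm)) fun a => ?_
  have e : opTensor x y (HTensor.ofAlg H K a) = HTensor.ofAlg H K (TensorProduct.mapL x y a) :=
    ContinuousLinearMap.completion_apply_coe (TensorProduct.mapL x y) a
  have n : ∀ b, ‖HTensor.ofAlg H K b‖ = ‖b‖ := fun b => UniformSpace.Completion.norm_coe b
  change ‖opTensor x y (HTensor.ofAlg H K a)‖ ≤ _ * ‖HTensor.ofAlg H K a‖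
  rw [e, n, n]
  exact (ContinuousLinearMap.le_opNorm _ _).trans
    (mul_le_mul_of_nonneg_right (TensorProduct.norm_mapL_le x y) (norm_nonneg a))

theorem star_opTensor (x : H →L[ℂ] H) (y : K →L[ℂ] K) :
    star (opTensor x y) = opTensor (star x) (star y) := by
  refine htensor_ext fun a b => ext_inner_right ℂ fun ξ => ?_
  let V : Submodule ℂ (HTensor H K) := LinearMap.eqLocus
    (innerSL ℂ (star (opTensor x y) (tmulL H K a b))).toLinearMap
    (innerSL ℂ (opTensor (star x) (star y) (tmulL H K a b))).toLinearMap
  refine htensor_induction (V := V)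
    (isClosed_eq (ContinuousLinearMap.continuous _) (ContinuousLinearMap.continuous _))
    (fun h k => ?_) ξ
  change ⟪star (opTensor x y) (tmulL H K a b), tmulL H K h k⟫_ℂ
    = ⟪opTensor (star x) (star y) (tmulL H K a b), tmulL H K h k⟫_ℂ
  rw [ContinuousLinearMap.star_eq_adjoint, ContinuousLinearMap.adjoint_inner_left]
  simp [inner_tmulL, ContinuousLinearMap.star_eq_adjoint, ContinuousLinearMap.adjoint_inner_left]

theorem opTensor_mul (x x' : H →L[ℂ] H) (y y' : K →L[ℂ] K) :
    opTensor x y * opTensor x' y' = opTensor (x * x') (y * y') :=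
  htensor_ext fun a b => by simp

theorem opTensor_one : opTensor (1 : H →L[ℂ] H) (1 : K →L[ℂ] K) = 1 :=
  htensor_ext fun a b => by simp

/-- The von Neumann algebra tensor product `N ⊗ M`, generated by the operators `x ⊗ y`. -/
def vnTensor (N : VonNeumannAlgebra H) (M : VonNeumannAlgebra K) :
    VonNeumannAlgebra (HTensor H K) :=
  vnGen {z | ∃ x ∈ N, ∃ y ∈ M, z = opTensor x y}

variable {N : VonNeumannAlgebra H} {M : VonNeumannAlgebra K}

/-- The element `x ⊗ y` of `N ⊗ M`. -/
def tmulEl (x : El N) (y : El M) : El (vnTensor N M) :=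
  El.mk (opTensor x.op y.op) (subset_vnGen _ ⟨x.op, x.op_mem, y.op, y.op_mem, rfl⟩)

@[simp]
theorem op_tmulEl (x : El N) (y : El M) :
    (tmulEl x y).op = opTensor x.op y.op := rfl

theorem tmulEl_mul (x x' : El N) (y y' : El M) :
    tmulEl x y * tmulEl x' y' = tmulEl (x * x') (y * y') :=
  El.ext (opTensor_mul _ _ _ _)

theorem tmulEl_one : tmulEl (1 : El N) (1 : El M) = 1 := El.ext opTensor_one

variable (N M) in
/-- The map `x ↦ x ⊗ 1`. -/
def inclLeft : El N →L[ℂ] El (vnTensor N M) :=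
  LinearMap.mkContinuous
    { toFun := fun x => tmulEl x 1
      map_add' := fun x y => El.ext (htensor_ext fun a b => by simp)
      map_smul' := fun c x => El.ext (htensor_ext fun a b => by simp) }
    ‖(1 : K →L[ℂ] K)‖ fun x => by rw [mul_comm]; exact norm_opTensor_le _ _

variable (N M) in
/-- The map `y ↦ 1 ⊗ y`. -/
def inclRight : El M →L[ℂ] El (vnTensor N M) :=
  LinearMap.mkContinuous
    { toFun := fun y => tmulEl 1 y
      map_add' := fun x y => El.ext (htensor_ext fun a b => by simp)
      map_smul' := fun c x => El.ext (htensor_ext fun a b => by simp) }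
    ‖(1 : H →L[ℂ] H)‖ fun x => norm_opTensor_le _ _

@[simp]
theorem inclLeft_apply (x : El N) : inclLeft N M x = tmulEl x 1 := rfl

@[simp]
theorem inclRight_apply (y : El M) : inclRight N M y = tmulEl 1 y := rfl

/-! #### Slice maps -/

/-- The compression `B(h)* x B(h')` of an operator along a bilinear map `B`. -/
def compress (B : H →L[ℂ] K →L[ℂ] L) (h h' : H) (x : L →L[ℂ] L) : K →L[ℂ] K :=
  (B h).adjoint ∘L x ∘L B h'

theorem inner_compress (B : H →L[ℂ] K →L[ℂ] L) (h h' : H) (x : L →L[ℂ] L) (k k' : K) :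
    ⟪k, compress B h h' x k'⟫_ℂ = ⟪B h k, x (B h' k')⟫_ℂ := by
  simp [compress, ContinuousLinearMap.adjoint_inner_right]

theorem norm_compress_le (B : H →L[ℂ] K →L[ℂ] L) (h h' : H) (x : L →L[ℂ] L) :
    ‖compress B h h' x‖ ≤ ‖B‖ * ‖h‖ * (‖x‖ * (‖B‖ * ‖h'‖)) := by
  refine (ContinuousLinearMap.opNorm_comp_le _ _).trans ?_
  rw [LinearIsometryEquiv.norm_map]
  refine mul_le_mul (B.le_opNorm h) ?_ (norm_nonneg _) (by positivity)
  refine (ContinuousLinearMap.opNorm_comp_le _ _).trans ?_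
  exact mul_le_mul_of_nonneg_left (B.le_opNorm h') (norm_nonneg x)

/-- All compressions of elements of `A` along `B` lie in `M`. -/
def Compressible (B : H →L[ℂ] K →L[ℂ] L) (A : VonNeumannAlgebra L) (M : VonNeumannAlgebra K) :
    Prop :=
  ∀ h h', ∀ x ∈ A, compress B h h' x ∈ M

variable {B : H →L[ℂ] K →L[ℂ] L} {A : VonNeumannAlgebra L}

/-- The compression as a map `A → M`. -/
def compressEl (hB : Compressible B A M) (h h' : H) : El A →L[ℂ] El M :=
  LinearMap.mkContinuous
    { toFun := fun x => El.mk (compress B h h' x.op) (hB h h' x.op x.op_mem)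
      map_add' := fun x y => El.ext (by ext; simp [compress])
      map_smul' := fun c x => El.ext (by ext; simp [compress]) }
    (‖B‖ * ‖h‖ * (‖B‖ * ‖h'‖)) fun x => by
      refine (norm_compress_le B h h' x.op).trans (le_of_eq ?_)
      rw [El.norm_op]
      ring

@[simp]
theorem op_compressEl (hB : Compressible B A M) (h h' : H) (x : El A) :
    (compressEl hB h h' x).op = compress B h h' x.op := rfl

theorem norm_compressEl_apply_le (hB : Compressible B A M) (h h' : H) (x : El A) :
    ‖compressEl hB h h' x‖ ≤ ‖B‖ * ‖h‖ * (‖x‖ * (‖B‖ * ‖h'‖)) :=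
  norm_compress_le B h h' x.op

/-- Compressions are normal. -/
theorem compressEl_normal (hB : Compressible B A M) (h h' : H) (k k' : K) :
    vecFunctional M k k' ∘L compressEl hB h h' ∈ predual A := by
  convert vecFunctional_mem A (B h k) (B h' k') using 1
  ext x
  exact inner_compress B h h' x.op k k'

/-- The sesquilinear form `(h, h') ↦ ψ (B(h)* x B(h'))`. -/
def sliceForm (hB : Compressible B A M) (ψ : StrongDual ℂ (El M)) (x : El A) :
    H →L⋆[ℂ] H →L[ℂ] ℂ :=
  LinearMap.mkContinuous₂
    (LinearMap.mk₂'ₛₗ (starRingEnd ℂ) (RingHom.id ℂ) (fun h h' => ψ (compressEl hB h h' x))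
      (fun h₁ h₂ h' => by
        rw [← map_add]; congr 1; exact El.ext (by ext; simp [compress]))
      (fun c h h' => by
        rw [← map_smul]; congr 1; exact El.ext (by ext; simp [compress, map_smulₛₗ]))
      (fun h h₁ h₂ => by
        rw [← map_add]; congr 1; exact El.ext (by ext; simp [compress]))
      (fun c h h' => by
        rw [← map_smul]; congr 1; exact El.ext (by ext; simp [compress])))
    (‖ψ‖ * (‖B‖ * ‖x‖ * ‖B‖)) (fun h h' => by
      refine (ψ.le_opNorm _).trans ?_
      refine (mul_le_mul_of_nonneg_left (norm_compressEl_apply_le hB h h' x)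
        (norm_nonneg ψ)).trans (le_of_eq ?_)
      ring)

/-- The slice `S` of `x` by `ψ`: the operator on `H` with `⟨h, S h'⟩ = ψ (B(h)* x B(h'))`. -/
def slice (hB : Compressible B A M) (ψ : StrongDual ℂ (El M)) (x : El A) : H →L[ℂ] H :=
  (InnerProductSpace.continuousLinearMapOfBilin (sliceForm hB ψ x)).adjoint

theorem inner_slice (hB : Compressible B A M) (ψ : StrongDual ℂ (El M)) (x : El A) (h h' : H) :
    ⟪h, slice hB ψ x h'⟫_ℂ = ψ (compressEl hB h h' x) := by
  rw [slice, ContinuousLinearMap.adjoint_inner_right,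
    InnerProductSpace.continuousLinearMapOfBilin_apply]
  rfl

theorem op_ext_inner {S T : H →L[ℂ] H} (h : ∀ a b, ⟪a, S b⟫_ℂ = ⟪a, T b⟫_ℂ) : S = T := by
  ext b
  exact ext_inner_left ℂ fun a => h a b

theorem norm_slice_le (hB : Compressible B A M) (ψ : StrongDual ℂ (El M)) (x : El A) :
    ‖slice hB ψ x‖ ≤ ‖ψ‖ * (‖B‖ * ‖x‖ * ‖B‖) := by
  refine ContinuousLinearMap.opNorm_le_bound _ (by positivity) fun b => ?_
  have h1 : ‖slice hB ψ x b‖ * ‖slice hB ψ x b‖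
      ≤ ‖slice hB ψ x b‖ * (‖ψ‖ * (‖B‖ * ‖x‖ * ‖B‖) * ‖b‖) := by
    calc ‖slice hB ψ x b‖ * ‖slice hB ψ x b‖
        = ‖⟪slice hB ψ x b, slice hB ψ x b⟫_ℂ‖ := by
          rw [inner_self_eq_norm_sq_to_K]; simp [pow_two]
      _ = ‖ψ (compressEl hB (slice hB ψ x b) b x)‖ := by rw [inner_slice]
      _ ≤ ‖ψ‖ * (‖B‖ * ‖slice hB ψ x b‖ * (‖x‖ * (‖B‖ * ‖b‖))) :=
        (ψ.le_opNorm _).trans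
          (mul_le_mul_of_nonneg_left (norm_compressEl_apply_le hB _ b x) (norm_nonneg ψ))
      _ = _ := by ring
  rcases (norm_nonneg (slice hB ψ x b)).eq_or_lt with h0 | hpos
  · rw [← h0]; positivity
  · exact le_of_mul_le_mul_left h1 hpos

/-- If all slices of elements of `A` lie in `N`, the slice map `A → N`. -/
def sliceL (hB : Compressible B A M) (N : VonNeumannAlgebra H) (ψ : StrongDual ℂ (El M))
    (hN : ∀ x, slice hB ψ x ∈ N) : El A →L[ℂ] El N :=
  LinearMap.mkContinuous
    { toFun := fun x => El.mk (slice hB ψ x) (hN x)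
      map_add' := fun x y => El.ext (op_ext_inner fun a b => by
        simp [inner_slice])
      map_smul' := fun c x => El.ext (op_ext_inner fun a b => by
        simp [inner_slice]) }
    (‖ψ‖ * (‖B‖ * ‖B‖)) fun x => by
      refine (norm_slice_le hB ψ x).trans (le_of_eq ?_)
      ring

@[simp]
theorem op_sliceL (hB : Compressible B A M) (ψ : StrongDual ℂ (El M))
    (hN : ∀ x, slice hB ψ x ∈ N) (x : El A) :
    (sliceL hB N ψ hN x).op = slice hB ψ x := rfl

/-- Slicing with a normal functional is normal. -/
theorem sliceL_normal (hB : Compressible B A M) (ψ : Predual M)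
    (hN : ∀ x, slice hB ψ.toDual x ∈ N) (h h' : H) :
    vecFunctional N h h' ∘L sliceL hB N ψ.toDual hN ∈ predual A := by
  convert (predualMap (compressEl hB h h') (compressEl_normal hB h h') ψ).toDual_mem using 1
  ext x
  exact inner_slice hB ψ.toDual x h h'

theorem slice_mul_right (hB : Compressible B A M) (ψ : StrongDual ℂ (El M)) (x y : El A)
    (n : H →L[ℂ] H) (hy : ∀ h k, y.op (B h k) = B (n h) k) :
    slice hB ψ (x * y) = slice hB ψ x * n := by
  refine op_ext_inner fun a b => ?_
  rw [inner_slice, mul_apply_eq_comp, inner_slice]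
  congr 1
  refine El.ext (op_ext_inner fun k k' => ?_)
  simp [inner_compress, hy]

theorem slice_mul_left (hB : Compressible B A M) (ψ : StrongDual ℂ (El M)) (x y : El A)
    (n : H →L[ℂ] H) (hy : ∀ h k, star y.op (B h k) = B (star n h) k) :
    slice hB ψ (y * x) = n * slice hB ψ x := by
  refine op_ext_inner fun a b => ?_
  rw [inner_slice, mul_apply_eq_comp, ← ContinuousLinearMap.adjoint_inner_left,
    inner_slice]
  congr 1
  refine El.ext (op_ext_inner fun k k' => ?_)
  have := hy a k
  rw [ContinuousLinearMap.star_eq_adjoint, ContinuousLinearMap.star_eq_adjoint] at this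
  simp [inner_compress, ← this, ContinuousLinearMap.adjoint_inner_left]

end Tensor

/-! ### Slice maps, product functionals and conditional expectations on `N ⊗ M` -/

section Product

variable {H K : Type*} [NormedAddCommGroup H] [InnerProductSpace ℂ H] [CompleteSpace H]
  [NormedAddCommGroup K] [InnerProductSpace ℂ K] [CompleteSpace K]
  {N : VonNeumannAlgebra H} {M : VonNeumannAlgebra K}

theorem mem_vn_iff {x : H →L[ℂ] H} : x ∈ N ↔ ∀ z ∈ N.commutant, z * x = x * z := by
  rw [← VonNeumannAlgebra.mem_commutant_iff, VonNeumannAlgebra.commutant_commutant]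

theorem commute_tensor_left {z : H →L[ℂ] H} (hz : z ∈ N.commutant) {x : HTensor H K →L[ℂ] HTensor H K}
    (hx : x ∈ vnTensor N M) : opTensor z 1 * x = x * opTensor z 1 := by
  have h1 := VonNeumannAlgebra.mem_commutant_iff.1 hz
  have h2 := VonNeumannAlgebra.mem_commutant_iff.1 (star_mem hz)
  refine commute_of_mem_vnGen hx ?_ ?_
  · rintro _ ⟨a, ha, b, hb, rfl⟩
    rw [opTensor_mul, opTensor_mul, h1 a ha, one_mul, mul_one]
  · rintro _ ⟨a, ha, b, hb, rfl⟩
    rw [star_opTensor, star_one, opTensor_mul, opTensor_mul, h2 a ha, one_mul, mul_one]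

theorem commute_tensor_right {z : K →L[ℂ] K} (hz : z ∈ M.commutant)
    {x : HTensor H K →L[ℂ] HTensor H K}
    (hx : x ∈ vnTensor N M) : opTensor 1 z * x = x * opTensor 1 z := by
  have h1 := VonNeumannAlgebra.mem_commutant_iff.1 hz
  have h2 := VonNeumannAlgebra.mem_commutant_iff.1 (star_mem hz)
  refine commute_of_mem_vnGen hx ?_ ?_
  · rintro _ ⟨a, ha, b, hb, rfl⟩
    rw [opTensor_mul, opTensor_mul, h1 b hb, one_mul, mul_one]
  · rintro _ ⟨a, ha, b, hb, rfl⟩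
    rw [star_opTensor, star_one, opTensor_mul, opTensor_mul, h2 b hb, one_mul, mul_one]

theorem inner_op_left {L : Type*} [NormedAddCommGroup L] [InnerProductSpace ℂ L] [CompleteSpace L]
    (z : L →L[ℂ] L) (a b : L) : ⟪a, z b⟫_ℂ = ⟪star z a, b⟫_ℂ := by
  rw [ContinuousLinearMap.star_eq_adjoint, ContinuousLinearMap.adjoint_inner_left]

theorem compressible_right : Compressible (tmulL H K) (vnTensor N M) M := by
  intro h h' x hx
  rw [mem_vn_iff]
  intro z hz
  refine op_ext_inner fun k k' => ?_
  rw [mul_apply_eq_comp, mul_apply_eq_comp, inner_op_left, inner_compress, inner_compress]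
  have h1 : tmulL H K h (star z k) = star (opTensor 1 z) (tmulL H K h k) := by
    simp [star_opTensor]
  have h2 : tmulL H K h' (z k') = opTensor 1 z (tmulL H K h' k') := by simp
  rw [h1, h2, ← inner_op_left, ← mul_apply_eq_comp, ← mul_apply_eq_comp, commute_tensor_right hz hx]

theorem compressible_left : Compressible (tmulL H K).flip (vnTensor N M) N := by
  intro k k' x hx
  rw [mem_vn_iff]
  intro z hz
  refine op_ext_inner fun h h' => ?_
  rw [mul_apply_eq_comp, mul_apply_eq_comp, inner_op_left, inner_compress, inner_compress]
  have h1 : (tmulL H K).flip k (star z h) = star (opTensor z 1) ((tmulL H K).flip k h) := by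
    simp [star_opTensor]
  have h2 : (tmulL H K).flip k' (z h') = opTensor z 1 ((tmulL H K).flip k' h') := by simp
  rw [h1, h2, ← inner_op_left, ← mul_apply_eq_comp, ← mul_apply_eq_comp, commute_tensor_left hz hx]

theorem slice_mem_left (ψ : StrongDual ℂ (El M)) (x : El (vnTensor N M)) :
    slice compressible_right ψ x ∈ N := by
  rw [mem_vn_iff]
  intro z hz
  refine op_ext_inner fun h h' => ?_
  rw [mul_apply_eq_comp, mul_apply_eq_comp, inner_op_left, inner_slice, inner_slice]
  congr 1
  refine El.ext (op_ext_inner fun k k' => ?_)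
  rw [op_compressEl, op_compressEl, inner_compress, inner_compress]
  have h1 : tmulL H K (star z h) k = star (opTensor z 1) (tmulL H K h k) := by
    simp [star_opTensor]
  have h2 : tmulL H K (z h') k' = opTensor z 1 (tmulL H K h' k') := by simp
  rw [h1, h2, ← inner_op_left, ← mul_apply_eq_comp, ← mul_apply_eq_comp, commute_tensor_left hz x.op_mem]

theorem slice_mem_right (φ : StrongDual ℂ (El N)) (x : El (vnTensor N M)) :
    slice compressible_left φ x ∈ M := by
  rw [mem_vn_iff]
  intro z hz
  refine op_ext_inner fun k k' => ?_
  rw [mul_apply_eq_comp, mul_apply_eq_comp, inner_op_left, inner_slice, inner_slice]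
  congr 1
  refine El.ext (op_ext_inner fun h h' => ?_)
  rw [op_compressEl, op_compressEl, inner_compress, inner_compress]
  have h1 : (tmulL H K).flip (star z k) h = star (opTensor 1 z) ((tmulL H K).flip k h) := by
    simp [star_opTensor]
  have h2 : (tmulL H K).flip (z k') h' = opTensor 1 z ((tmulL H K).flip k' h') := by simp
  rw [h1, h2, ← inner_op_left, ← mul_apply_eq_comp, ← mul_apply_eq_comp, commute_tensor_right hz x.op_mem]

variable (N) in
/-- The slice map `ι ⊗ ψ : N ⊗ M → N`. -/
def sliceToLeft (ψ : StrongDual ℂ (El M)) : El (vnTensor N M) →L[ℂ] El N :=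
  sliceL compressible_right N ψ (slice_mem_left ψ)

variable (M) in
/-- The slice map `φ ⊗ ι : N ⊗ M → M`. -/
def sliceToRight (φ : StrongDual ℂ (El N)) : El (vnTensor N M) →L[ℂ] El M :=
  sliceL compressible_left M φ (slice_mem_right φ)

/-- The product functional `φ ⊗ ψ` on `N ⊗ M`, defined as `φ ∘ (ι ⊗ ψ)`. -/
def prodFunctional (φ : Predual N) (ψ : Predual M) : Predual (vnTensor N M) :=
  predualMap (sliceToLeft N ψ.toDual)
    (sliceL_normal compressible_right ψ (slice_mem_left _)) φ

theorem prodFunctional_apply (φ : Predual N) (ψ : Predual M) (x : El (vnTensor N M)) :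
    prodFunctional φ ψ x
      = φ (sliceToLeft N ψ.toDual x) := rfl

theorem sliceToLeft_tmul (ψ : StrongDual ℂ (El M)) (x : El N) (y : El M) :
    sliceToLeft N ψ (tmulEl x y) = ψ y • x := by
  refine El.ext (op_ext_inner fun h h' => ?_)
  have e : compressEl (compressible_right (N := N) (M := M)) h h' (tmulEl x y)
      = ⟪h, x.op h'⟫_ℂ • y := by
    refine El.ext (op_ext_inner fun k k' => ?_)
    simp [inner_compress, inner_tmulL]
  change ⟪h, slice compressible_right ψ (tmulEl x y) h'⟫_ℂ = _
  rw [inner_slice, e]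
  simp [mul_comm]

theorem sliceToRight_tmul (φ : StrongDual ℂ (El N)) (x : El N) (y : El M) :
    sliceToRight M φ (tmulEl x y) = φ x • y := by
  refine El.ext (op_ext_inner fun k k' => ?_)
  have e : compressEl (compressible_left (N := N) (M := M)) k k' (tmulEl x y)
      = ⟪k, y.op k'⟫_ℂ • x := by
    refine El.ext (op_ext_inner fun h h' => ?_)
    simp [inner_compress, inner_tmulL, mul_comm]
  change ⟪k, slice compressible_left φ (tmulEl x y) k'⟫_ℂ = _
  rw [inner_slice, e]
  simp [mul_comm]

/-- `(φ ⊗ ψ)(x ⊗ y) = φ(x) ψ(y)`, which determines the normal functional `φ ⊗ ψ`. -/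
theorem prodFunctional_tmul (φ : Predual N) (ψ : Predual M) (x : El N) (y : El M) :
    prodFunctional φ ψ (tmulEl x y)
      = φ x * ψ y := by
  rw [prodFunctional_apply, sliceToLeft_tmul, map_smul, smul_eq_mul, mul_comm]

/-- `φ ⊗ ψ` is also `ψ ∘ (φ ⊗ ι)`. -/
theorem prodFunctional_apply' (φ : Predual N) (ψ : Predual M) (x : El (vnTensor N M)) :
    prodFunctional φ ψ x
      = ψ (sliceToRight M φ.toDual x) := by
  let T : StrongDual ℂ (El N) →L[ℂ] El M := LinearMap.mkContinuous
    { toFun := fun φ => sliceToRight M φ x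
      map_add' := fun φ φ' => El.ext (op_ext_inner fun a b => by
        simp [sliceToRight, inner_slice])
      map_smul' := fun c φ => El.ext (op_ext_inner fun a b => by
        simp [sliceToRight, inner_slice]) }
    (‖(tmulL H K).flip‖ * ‖x‖ * ‖(tmulL H K).flip‖) fun φ => by
      rw [mul_comm]
      exact norm_slice_le compressible_left φ x
  let ψ' : StrongDual ℂ (El M) := ψ.toDual
  let f₁ : StrongDual ℂ (El N) →L[ℂ] ℂ :=
    ContinuousLinearMap.apply ℂ ℂ (sliceToLeft N ψ' x)
  let f₂ : StrongDual ℂ (El N) →L[ℂ] ℂ := ψ' ∘L T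
  refine predual_induction (V := LinearMap.eqLocus f₁.toLinearMap f₂.toLinearMap)
    (isClosed_eq f₁.continuous f₂.continuous) (fun h h' => ?_) φ.toDual_mem
  change vecFunctional N h h' (sliceToLeft N ψ' x) = ψ' (sliceToRight M (vecFunctional N h h') x)
  refine (inner_slice compressible_right ψ' x h h').trans ?_
  congr 1
  refine El.ext (op_ext_inner fun k k' => ?_)
  refine (inner_compress _ _ _ _ _ _).trans ?_
  refine Eq.trans ?_ (inner_slice compressible_left _ x k k').symm
  refine Eq.trans ?_ (inner_compress (tmulL H K).flip k k' x.op h h').symm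
  rfl

theorem normal_of_tmul {L : Type*} [NormedAddCommGroup L] [InnerProductSpace ℂ L] [CompleteSpace L]
    {A : VonNeumannAlgebra L} (R : El A →L[ℂ] El (vnTensor N M))
    (hR : ∀ h k h' k', vecFunctional (vnTensor N M) (tmulL H K h k) (tmulL H K h' k') ∘L R
      ∈ predual A) (ξ η : HTensor H K) :
    vecFunctional (vnTensor N M) ξ η ∘L R ∈ predual A := by
  have step : ∀ h' k', vecFunctional (vnTensor N M) ξ (tmulL H K h' k') ∘L R ∈ predual A := by
    intro h' k'
    let V : Submodule ℂ (HTensor H K) :=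
      { carrier := {a | vecFunctional (vnTensor N M) a (tmulL H K h' k') ∘L R ∈ predual A}
        zero_mem' := by
          change _ ∈ predual A
          convert (predual A).zero_mem using 1
          ext x; simp
        add_mem' := fun {a b} ha hb => by
          change _ ∈ predual A
          convert (predual A).add_mem ha hb using 1
          ext x; simp
        smul_mem' := fun c a ha => by
          change _ ∈ predual A
          convert (predual A).smul_mem (starRingEnd ℂ c) ha using 1
          ext x; simp [mul_comm] }
    refine htensor_induction (V := V) ?_ (fun h k => hR h k h' k') ξ
    refine (predual_isClosed A).preimage ?_
    unfold vecFunctional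
    exact ((innerSL ℂ).continuous.clm_comp continuous_const).clm_comp continuous_const
  let V : Submodule ℂ (HTensor H K) :=
    { carrier := {b | vecFunctional (vnTensor N M) ξ b ∘L R ∈ predual A}
      zero_mem' := by
        change _ ∈ predual A
        convert (predual A).zero_mem using 1
        ext x; simp
      add_mem' := fun {a b} ha hb => by
        change _ ∈ predual A
        convert (predual A).add_mem ha hb using 1
        ext x; simp
      smul_mem' := fun c a ha => by
        change _ ∈ predual A
        convert (predual A).smul_mem c ha using 1
        ext x; simp }
  refine htensor_induction (V := V) ?_ step η
  refine (predual_isClosed A).preimage ?_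
  unfold vecFunctional
  exact (continuous_const.clm_comp
    ((ContinuousLinearMap.apply ℂ (HTensor H K)).continuous.clm_comp continuous_const)).clm_comp
      continuous_const

/-- `x ↦ x ⊗ 1` is normal. -/
theorem inclLeft_normal (ξ η : HTensor H K) :
    vecFunctional (vnTensor N M) ξ η ∘L inclLeft N M ∈ predual N := by
  refine normal_of_tmul _ (fun h k h' k' => ?_) ξ η
  convert (predual N).smul_mem ⟪k, k'⟫_ℂ (vecFunctional_mem N h h') using 1
  ext x
  simp [inner_tmulL, mul_comm]

/-- `y ↦ 1 ⊗ y` is normal. -/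
theorem inclRight_normal (ξ η : HTensor H K) :
    vecFunctional (vnTensor N M) ξ η ∘L inclRight N M ∈ predual M := by
  refine normal_of_tmul _ (fun h k h' k' => ?_) ξ η
  convert (predual M).smul_mem ⟪h, h'⟫_ℂ (vecFunctional_mem M k k') using 1
  ext x
  simp [inner_tmulL]

variable (N) in
/-- The conditional expectation `E_N : N ⊗ M → N ⊗ 1`, `E_N(x) = (ι ⊗ ψ)(x) ⊗ 1`. For states `φ`
and `ψ` it preserves `φ ⊗ ψ`. -/
def condExpLeft (ψ : Predual M) : El (vnTensor N M) →L[ℂ] El (vnTensor N M) :=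
  inclLeft N M ∘L sliceToLeft N ψ.toDual

variable (M) in
/-- The conditional expectation `E_M : N ⊗ M → 1 ⊗ M`, `E_M(x) = 1 ⊗ (φ ⊗ ι)(x)`. For states `φ`
and `ψ` it preserves `φ ⊗ ψ`. -/
def condExpRight (φ : Predual N) : El (vnTensor N M) →L[ℂ] El (vnTensor N M) :=
  inclRight N M ∘L sliceToRight M φ.toDual

variable (N) in
/-- The map `ω ↦ ω|_{N ⊗ 1} ∘ E_N` on the predual. -/
def condExpLeftPredual (ψ : Predual M) : Predual (vnTensor N M) →L[ℂ] Predual (vnTensor N M) :=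
  predualMap (condExpLeft N ψ) fun ξ η =>
    (predualMap (sliceToLeft N ψ.toDual)
      (sliceL_normal compressible_right ψ (slice_mem_left _))
      ⟨vecFunctional (vnTensor N M) ξ η ∘L inclLeft N M, inclLeft_normal ξ η⟩).toDual_mem

variable (M) in
/-- The map `ω ↦ ω|_{1 ⊗ M} ∘ E_M` on the predual. -/
def condExpRightPredual (φ : Predual N) : Predual (vnTensor N M) →L[ℂ] Predual (vnTensor N M) :=
  predualMap (condExpRight M φ) fun ξ η =>
    (predualMap (sliceToRight M φ.toDual)
      (sliceL_normal compressible_left φ (slice_mem_right _))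
      ⟨vecFunctional (vnTensor N M) ξ η ∘L inclRight N M, inclRight_normal ξ η⟩).toDual_mem

end Product

/-! ### The projections `F_{N,j}^p` and `F_{M,i}^p` -/

section Projections

variable {H K : Type*} [NormedAddCommGroup H] [InnerProductSpace ℂ H] [CompleteSpace H]
  [NormedAddCommGroup K] [InnerProductSpace ℂ K] [CompleteSpace K]
  {N : VonNeumannAlgebra H} {M : VonNeumannAlgebra K}

theorem sliceToLeft_mul_right (ψ : StrongDual ℂ (El M)) (x : El (vnTensor N M)) (n : El N) :
    sliceToLeft N ψ (x * tmulEl n 1) = sliceToLeft N ψ x * n :=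
  El.ext (slice_mul_right compressible_right ψ x (tmulEl n 1) n.op fun h k => by simp)

theorem sliceToLeft_mul_left (ψ : StrongDual ℂ (El M)) (x : El (vnTensor N M)) (n : El N) :
    sliceToLeft N ψ (tmulEl n 1 * x) = n * sliceToLeft N ψ x :=
  El.ext (slice_mul_left compressible_right ψ x (tmulEl n 1) n.op fun h k => by
    simp [star_opTensor])

theorem sliceToRight_mul_right (φ : StrongDual ℂ (El N)) (x : El (vnTensor N M)) (m : El M) :
    sliceToRight M φ (x * tmulEl 1 m) = sliceToRight M φ x * m :=
  El.ext (slice_mul_right compressible_left φ x (tmulEl 1 m) m.op fun k h => by simp)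

theorem sliceToRight_mul_left (φ : StrongDual ℂ (El N)) (x : El (vnTensor N M)) (m : El M) :
    sliceToRight M φ (tmulEl 1 m * x) = m * sliceToRight M φ x :=
  El.ext (slice_mul_left compressible_left φ x (tmulEl 1 m) m.op fun k h => by
    simp [star_opTensor])

/-- `E_N` preserves `φ ⊗ ψ`. -/
theorem prodFunctional_condExpLeft (φ : Predual N) (ψ : Predual M)
    (hψ : ψ 1 = 1) (x : El (vnTensor N M)) :
    prodFunctional φ ψ (condExpLeft N ψ x)
      = prodFunctional φ ψ x := by
  simp [prodFunctional_apply, condExpLeft, sliceToLeft_tmul, hψ]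

/-- `E_M` preserves `φ ⊗ ψ`. -/
theorem prodFunctional_condExpRight (φ : Predual N) (ψ : Predual M)
    (hφ : φ 1 = 1) (x : El (vnTensor N M)) :
    prodFunctional φ ψ (condExpRight M φ x)
      = prodFunctional φ ψ x := by
  simp [prodFunctional_apply', condExpRight, sliceToRight_tmul, hφ]

theorem lmul_compat (N : VonNeumannAlgebra H) (ω : Predual N) (a x : El N) :
    lmulPredual N a (leftInj N ω x) = leftInj N ω (lmul N a x) := by
  refine Predual.ext fun y => ?_
  simp [lmul, mul_assoc]

theorem condExpLeft_compat (φ : Predual N) (ψ : Predual M) (x : El (vnTensor N M)) :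
    condExpLeftPredual N ψ (leftInj (vnTensor N M) (prodFunctional φ ψ) x)
      = leftInj (vnTensor N M) (prodFunctional φ ψ) (condExpLeft N ψ x) := by
  refine Predual.ext fun y => ?_
  simp [condExpLeftPredual, condExpLeft, prodFunctional_apply, sliceToLeft_mul_left,
    sliceToLeft_mul_right]

theorem condExpRight_compat (φ : Predual N) (ψ : Predual M) (x : El (vnTensor N M)) :
    condExpRightPredual M φ (leftInj (vnTensor N M) (prodFunctional φ ψ) x)
      = leftInj (vnTensor N M) (prodFunctional φ ψ) (condExpRight M φ x) := by
  refine Predual.ext fun y => ?_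
  simp [condExpRightPredual, condExpRight, prodFunctional_apply', sliceToRight_mul_left,
    sliceToRight_mul_right]

/-- Left multiplication on `L^p(N)`, interpolated between left multiplication on `N` and `N_*`. -/
def lmulLp (N : VonNeumannAlgebra H) (ω : Predual N) (p : ℝ≥0∞) [Fact (1 ≤ p)] (a : El N) :
    Lp N ω p →L[ℂ] Lp N ω p :=
  Interp.map (A₀ := El N) (A₁ := Predual N) (B₀ := El N) (B₁ := Predual N)
    (ι := leftInj N ω) (κ := leftInj N ω) (lmul N a) (lmulPredual N a) (lmul_compat N ω a) (param p)

/-- The interpolated conditional expectation `E_N^p` on `L^p(N ⊗ M)`. -/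
def condExpLeftLp (φ : Predual N) (ψ : Predual M) (p : ℝ≥0∞) [Fact (1 ≤ p)] :
    Lp (vnTensor N M) (prodFunctional φ ψ) p →L[ℂ] Lp (vnTensor N M) (prodFunctional φ ψ) p :=
  Interp.map (A₀ := El (vnTensor N M)) (A₁ := Predual (vnTensor N M))
    (B₀ := El (vnTensor N M)) (B₁ := Predual (vnTensor N M))
    (ι := leftInj (vnTensor N M) (prodFunctional φ ψ))
    (κ := leftInj (vnTensor N M) (prodFunctional φ ψ))
    (condExpLeft N ψ) (condExpLeftPredual N ψ) (condExpLeft_compat φ ψ) (param p)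

/-- The interpolated conditional expectation `E_M^p` on `L^p(N ⊗ M)`. -/
def condExpRightLp (φ : Predual N) (ψ : Predual M) (p : ℝ≥0∞) [Fact (1 ≤ p)] :
    Lp (vnTensor N M) (prodFunctional φ ψ) p →L[ℂ] Lp (vnTensor N M) (prodFunctional φ ψ) p :=
  Interp.map (A₀ := El (vnTensor N M)) (A₁ := Predual (vnTensor N M))
    (B₀ := El (vnTensor N M)) (B₁ := Predual (vnTensor N M))
    (ι := leftInj (vnTensor N M) (prodFunctional φ ψ))
    (κ := leftInj (vnTensor N M) (prodFunctional φ ψ))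
    (condExpRight M φ) (condExpRightPredual M φ) (condExpRight_compat φ ψ) (param p)

/-- `F_{N,j}^p`, the interpolation of `F_{N,j}(x) = (1 ⊗ v_j) E_N((1 ⊗ v_j*) x)`. -/
def projLeft (φ : Predual N) (ψ : Predual M) (p : ℝ≥0∞) [Fact (1 ≤ p)] (v : El M) :
    Lp (vnTensor N M) (prodFunctional φ ψ) p →L[ℂ] Lp (vnTensor N M) (prodFunctional φ ψ) p :=
  lmulLp (vnTensor N M) (prodFunctional φ ψ) p (tmulEl 1 v) ∘L condExpLeftLp φ ψ p ∘L
    lmulLp (vnTensor N M) (prodFunctional φ ψ) p (tmulEl 1 (star v))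

/-- `F_{M,i}^p`, the interpolation of `F_{M,i}(x) = (u_i ⊗ 1) E_M((u_i* ⊗ 1) x)`. -/
def projRight (φ : Predual N) (ψ : Predual M) (p : ℝ≥0∞) [Fact (1 ≤ p)] (u : El N) :
    Lp (vnTensor N M) (prodFunctional φ ψ) p →L[ℂ] Lp (vnTensor N M) (prodFunctional φ ψ) p :=
  lmulLp (vnTensor N M) (prodFunctional φ ψ) p (tmulEl u 1) ∘L condExpRightLp φ ψ p ∘L
    lmulLp (vnTensor N M) (prodFunctional φ ψ) p (tmulEl (star u) 1)

end Projections

/-! ### Schauder decompositions and the shell enumeration -/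

/-- A sequence of closed subspaces `V s` of `X` is a Schauder decomposition if every `x` is in a
unique way the sum of a convergent series `∑ y s` with `y s ∈ V s`. -/
structure IsSchauderDecomposition {X : Type*} [NormedAddCommGroup X] [NormedSpace ℂ X]
    (V : ℕ → Submodule ℂ X) : Prop where
  isClosed : ∀ s, IsClosed (V s : Set X)
  existsUnique : ∀ x : X, ∃! y : ℕ → X, (∀ s, y s ∈ V s) ∧
    Tendsto (fun n => ∑ s ∈ Finset.range n, y s) atTop (𝓝 x)

/-- The shell enumeration of `ℕ × ℕ`. -/
def shell (i j : ℕ) : ℕ := if i ≤ j then j ^ 2 + i else (i + 1) ^ 2 - j - 1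

theorem shell_bijective : Function.Bijective fun q : ℕ × ℕ => shell q.1 q.2 := by
  have key : ∀ l r l' r' : ℕ, r ≤ 2 * l → r' ≤ 2 * l' → l ^ 2 + r = l' ^ 2 + r' → l = l' := by
    intro l r l' r' h h' e
    by_contra hne
    rcases Nat.lt_or_gt_of_ne hne with h1 | h1 <;> nlinarith
  have hlt : ∀ i j : ℕ, j < i → shell i j = i ^ 2 + (2 * i - j) := by
    intro i j h
    have h2 : (i + 1) ^ 2 = i ^ 2 + 2 * i + 1 := by ring
    rw [shell, if_neg (by omega)]
    omega
  have hle : ∀ i j : ℕ, i ≤ j → shell i j = j ^ 2 + i := fun i j h => if_pos h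
  constructor
  · rintro ⟨i, j⟩ ⟨i', j'⟩ e
    change shell i j = shell i' j' at e
    rcases le_or_gt i j with h | h <;> rcases le_or_gt i' j' with h' | h'
    · rw [hle _ _ h, hle _ _ h'] at e
      have := key _ _ _ _ (by omega) (by omega) e
      subst this
      simpa using e
    · rw [hle _ _ h, hlt _ _ h'] at e
      have := key _ _ _ _ (by omega) (by omega) e
      subst this
      omega
    · rw [hlt _ _ h, hle _ _ h'] at e
      have := key _ _ _ _ (by omega) (by omega) e
      subst this
      omega
    · rw [hlt _ _ h, hlt _ _ h'] at e
      have := key _ _ _ _ (by omega) (by omega) e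
      subst this
      have : j = j' := by omega
      rw [this]
  · intro k
    have h1 := Nat.sqrt_le' k
    have h2 := Nat.lt_succ_sqrt' k
    set l := Nat.sqrt k
    have h3 : l.succ ^ 2 = l ^ 2 + 2 * l + 1 := by rw [Nat.succ_eq_add_one]; ring
    rcases le_or_gt (k - l ^ 2) l with h | h
    · exact ⟨(k - l ^ 2, l), by simp only; rw [hle _ _ h]; omega⟩
    · refine ⟨(l, 2 * l - (k - l ^ 2)), ?_⟩
      simp only
      rw [hlt _ _ (by omega)]
      omega

end NCLp

end

/-! Write ω = φ ⊗ ψ and e_ij = i^p(u_i ⊗ v_j). Seen inside the predual, F_{N,j} F_{M,i} and F_{M,i}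
F_{N,j} are the same rank-one operator x ↦ x(u_i* ⊗ v_j*) e_ij, because slicing with φ and ψ in
either order gives ω (`projLeft_projRight`, `projRight_projLeft`). Hence the two families of
idempotents commute, and the ranges of F_{N,j} and F_{M,i} meet exactly in the line through e_ij.

The unitaries are not assumed orthogonal, so F_{N,j} F_{N,k} need not vanish for j ≠ k and the F's
need not be the coordinate projections of the decompositions. The true coordinates Q_j and R_i, with
uniformly bounded partial sums, come from the open mapping theorem
(`IsSchauderDecomposition.exists_coord`); this is where completeness of L^p enters. Uniqueness of
expansions carries commutation over from the F's to the Q's and R's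
(`IsSchauderDecomposition.coord_comm`). Then R_i Q_j x is fixed by both idempotents, so it is a
multiple of e_ij with a continuous coefficient.

Convergence is `tendsto_sum_shell`. The sum over the first l² shell numbers is a product of two
partial-sum operators applied to x, and tends to x by the uniform bounds. The rest of the shell is a
partial sum of the R's at Q_l x plus a difference of two partial sums of the Q's at R_l x, and both
tend to 0. -/

noncomputable section

namespace NCLp

/-! ### Completeness of the interpolation spaces -/

section Completeness

/-- Evaluation at a point, on `C₀(ℝ, E)`. -/
def evalC₀ (E : Type*) [NormedAddCommGroup E] [NormedSpace ℂ E] (t : ℝ) : C₀(ℝ, E) →L[ℂ] E :=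
  LinearMap.mkContinuous
    { toFun := fun g => g t
      map_add' := fun _ _ => rfl
      map_smul' := fun _ _ => rfl }
    1 fun g => by simpa using C₀_norm_apply_le g t

@[simp]
theorem evalC₀_apply {E : Type*} [NormedAddCommGroup E] [NormedSpace ℂ E] (t : ℝ) (g : C₀(ℝ, E)) :
    evalC₀ E t g = g t := rfl

variable {A₀ A₁ : Type*} [NormedAddCommGroup A₀] [NormedSpace ℂ A₀]
  [NormedAddCommGroup A₁] [NormedSpace ℂ A₁] {ι : A₀ →L[ℂ] A₁}

theorem IsCalderon.neg {f : ℂ → A₁} {g : C₀(ℝ, A₀)} {h : C₀(ℝ, A₁)}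
    (H : IsCalderon ι f g h) : IsCalderon ι (-f) (-g) (-h) := by
  simpa using H.smul (-1)

theorem IsCalderon.sum {f : ℕ → ℂ → A₁} {g : ℕ → C₀(ℝ, A₀)} {h : ℕ → C₀(ℝ, A₁)}
    (H : ∀ n, IsCalderon ι (f n) (g n) (h n)) (s : Finset ℕ) :
    IsCalderon ι (∑ n ∈ s, f n) (∑ n ∈ s, g n) (∑ n ∈ s, h n) := by
  classical
  induction s using Finset.induction_on with
  | empty => simpa using IsCalderon.zero
  | insert a s ha ih =>
    rw [Finset.sum_insert ha, Finset.sum_insert ha, Finset.sum_insert ha]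
    exact (H a).add ih

/-- The maximum principle bounds each term on the whole strip by its boundary norms. The Weierstrass
M-test then passes continuity, boundedness and analyticity to the sum. -/
theorem IsCalderon.tsum [CompleteSpace A₀] [CompleteSpace A₁]
    {f : ℕ → ℂ → A₁} {g : ℕ → C₀(ℝ, A₀)} {h : ℕ → C₀(ℝ, A₁)}
    (H : ∀ n, IsCalderon ι (f n) (g n) (h n)) (hs : Summable fun n => max ‖g n‖ ‖h n‖) :
    IsCalderon ι (fun z => ∑' n, f n z) (∑' n, g n) (∑' n, h n) := by
  have hu : Summable fun n => max 1 ‖ι‖ * max ‖g n‖ ‖h n‖ := hs.mul_left _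
  have hb : ∀ n, ∀ z ∈ Complex.re ⁻¹' Icc 0 1, ‖f n z‖ ≤ max 1 ‖ι‖ * max ‖g n‖ ‖h n‖ :=
    fun n z hz => (H n).norm_le hz
  have hg : Summable g := Summable.of_norm_bounded hs fun n => le_max_left _ _
  have hh : Summable h := Summable.of_norm_bounded hs fun n => le_max_right _ _
  refine ⟨?_, ?_, ?_, ?_, ?_⟩
  · exact continuousOn_tsum (fun n => (H n).continuousOn) hu hb
  · exact ⟨_, fun z hz => tsum_of_norm_bounded hu.hasSum fun n => hb n z hz⟩
  · refine Complex.differentiableOn_tsum_of_summable_norm hu (fun n => (H n).differentiableOn)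
      (isOpen_Ioo.preimage Complex.continuous_re) fun n z hz => hb n z ?_
    exact ⟨hz.1.le, hz.2.le⟩
  · intro t
    have e := (hg.hasSum.mapL (ι ∘L evalC₀ A₀ t)).tsum_eq
    simpa [(H _).left_eq] using e
  · intro t
    have e := (hh.hasSum.mapL (evalC₀ A₁ t)).tsum_eq
    simpa [(H _).right_eq] using e

namespace Interp

variable {θ : unitInterval}

/-- The interpolation norm is a quotient norm, so an absolutely convergent series lifts to an
absolutely convergent series of Calderón functions, whose sum takes the required value at θ. -/
instance [CompleteSpace A₀] [CompleteSpace A₁] : CompleteSpace (Interp ι θ) := by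
  refine NormedAddCommGroup.completeSpace_of_summable_imp_tendsto fun a ha => ?_
  -- The infimum defining the norm may not be attained; the slack (1/2)^n is summable and costs
  -- nothing.
  have hex : ∀ n, ∃ f g h, IsCalderon ι f g h ∧ f ((θ : ℝ) : ℂ) = val ι θ (a n) ∧
      max ‖g‖ ‖h‖ < ‖a n‖ + (1 / 2) ^ n := fun n =>
    exists_of_lt (lt_add_of_pos_right _ (by positivity))
  choose f g h H e hlt using hex
  have hs : Summable fun n => max ‖g n‖ ‖h n‖ :=
    Summable.of_nonneg_of_le (fun n => le_max_of_le_left (norm_nonneg _)) (fun n => (hlt n).le)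
      (ha.add summable_geometric_two)
  have hg : Summable g := Summable.of_norm_bounded hs fun n => le_max_left _ _
  have hh : Summable h := Summable.of_norm_bounded hs fun n => le_max_right _ _
  have HT := IsCalderon.tsum H hs
  let b : Interp ι θ := ⟨_, _, _, _, HT, rfl⟩
  have hb : val ι θ b = ∑' n, f n ((θ : ℝ) : ℂ) := rfl
  refine ⟨b, ?_⟩
  rw [tendsto_iff_norm_sub_tendsto_zero]
  have hg0 : Tendsto (fun n => ‖∑ i ∈ Finset.range n, g i - ∑' i, g i‖) atTop (𝓝 0) :=
    tendsto_iff_norm_sub_tendsto_zero.1 hg.hasSum.tendsto_sum_nat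
  have hh0 : Tendsto (fun n => ‖∑ i ∈ Finset.range n, h i - ∑' i, h i‖) atTop (𝓝 0) :=
    tendsto_iff_norm_sub_tendsto_zero.1 hh.hasSum.tendsto_sum_nat
  refine squeeze_zero (fun n => norm_nonneg _) (fun n => ?_) (by simpa using hg0.max hh0)
  -- The error is represented by the partial sum minus the full sum of the lifts, so its norm is at
  -- most the boundary norms of that difference.
  refine norm_le_of (by simpa only [sub_eq_add_neg] using
    (IsCalderon.sum H (Finset.range n)).add HT.neg) ?_
  simp [hb, e, sub_eq_add_neg]

end Interp

end Completeness

/-! ### Completeness of von Neumann algebras and their preduals. -/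

section VonNeumann

variable {H : Type*} [NormedAddCommGroup H] [InnerProductSpace ℂ H] [CompleteSpace H]

instance (N : VonNeumannAlgebra H) : CompleteSpace (El N) := by
  -- The algebra is its own double commutant, and commutants are norm closed.
  have h : IsClosed (N.carrier : Set (H →L[ℂ] H)) := by
    rw [← N.centralizer_centralizer']
    exact Set.isClosed_centralizer _
  exact h.completeSpace_coe

instance (N : VonNeumannAlgebra H) : CompleteSpace (Predual N) :=
  (predual_isClosed N).completeSpace_coe

end VonNeumann

/-! ### Schauder decompositions of Banach spaces -/

section Decomposition

variable {X : Type*} [NormedAddCommGroup X] [NormedSpace ℂ X]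

/-- The sequences of partial sums of convergent series `∑ y s` with `y s ∈ V s`, together with their
limits, as a subspace of the continuous functions on `ℕ ∪ {∞}`. -/
def partialSums (V : ℕ → Submodule ℂ X) : Submodule ℂ C(OnePoint ℕ, X) where
  carrier := {f | f (0 : ℕ) = 0 ∧ ∀ s : ℕ, f (s + 1 : ℕ) - f s ∈ V s}
  zero_mem' := by simp
  add_mem' := by
    rintro f g ⟨hf, hf'⟩ ⟨hg, hg'⟩
    refine ⟨by simp [hf, hg], fun s => ?_⟩
    simpa [add_sub_add_comm] using (V s).add_mem (hf' s) (hg' s)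
  smul_mem' := by
    rintro c f ⟨hf, hf'⟩
    refine ⟨by simp [hf], fun s => ?_⟩
    simpa [smul_sub] using (V s).smul_mem c (hf' s)

theorem isClosed_partialSums {V : ℕ → Submodule ℂ X} (hV : ∀ s, IsClosed (V s : Set X)) :
    IsClosed (partialSums V : Set C(OnePoint ℕ, X)) := by
  have e : (partialSums V : Set C(OnePoint ℕ, X)) = {f | f (0 : ℕ) = 0} ∩
      ⋂ s : ℕ, {f | f (s + 1 : ℕ) - f s ∈ V s} := by
    ext f
    simp [partialSums]
  rw [e]
  refine (isClosed_eq (by fun_prop) continuous_const).inter (isClosed_iInter fun s => ?_)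
  exact (hV s).preimage (f := fun f : C(OnePoint ℕ, X) => f (s + 1 : ℕ) - f s) (by fun_prop)

variable {V : ℕ → Submodule ℂ X}

/-- The coordinate projections of a Schauder decomposition of a Banach space, and the uniform
boundedness of their partial sums. -/
theorem IsSchauderDecomposition.exists_coord [CompleteSpace X] (hV : IsSchauderDecomposition V) :
    ∃ Q : ℕ → X →L[ℂ] X, (∀ s x, Q s x ∈ V s) ∧
      (∀ x, Tendsto (fun n => ∑ s ∈ Finset.range n, Q s x) atTop (𝓝 x)) ∧
      ∃ C, ∀ n x, ‖∑ s ∈ Finset.range n, Q s x‖ ≤ C * ‖x‖ := by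
  -- With the sup norm on ℕ ∪ {∞}, the partial-sum sequences form a Banach space. Evaluation at ∞
  -- sends such a sequence to the sum of its series; unique expansions make this a continuous
  -- bijection onto X.
  have : CompleteSpace (partialSums V) := (isClosed_partialSums hV.isClosed).completeSpace_coe
  let ev (k : OnePoint ℕ) : partialSums V →L[ℂ] X :=
    (ContinuousMap.evalCLM ℂ k) ∘L (partialSums V).subtypeL
  have hev : ∀ k (f : partialSums V), ev k f = f.1 k := fun _ _ => rfl
  have htend : ∀ f : partialSums V, Tendsto (fun n : ℕ => f.1 n) atTop (𝓝 (f.1 OnePoint.infty)) := by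
    intro f
    have h := OnePoint.continuousAt_infty'.1 (f.1.continuous.continuousAt (x := OnePoint.infty))
    rwa [coclosedCompact_eq_cocompact, cocompact_eq_cofinite, Nat.cofinite_eq_atTop] at h
  have hsum : ∀ (f : partialSums V) (n : ℕ),
      ∑ s ∈ Finset.range n, (f.1 (s + 1 : ℕ) - f.1 s) = f.1 n := by
    intro f n
    rw [Finset.sum_range_sub (fun s : ℕ => f.1 s), f.2.1, sub_zero]
  -- Equal values at ∞ make both increment sequences expansions of one vector. As both sequences
  -- vanish at 0, equal increments give equal values.
  have hinj : Function.Injective (ev OnePoint.infty) := by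
    intro f g hfg
    obtain ⟨y, -, hy⟩ := hV.existsUnique (f.1 OnePoint.infty)
    have h1 := hy (fun s => f.1 (s + 1 : ℕ) - f.1 s) ⟨f.2.2, by simpa only [hsum] using htend f⟩
    have h2 := hy (fun s => g.1 (s + 1 : ℕ) - g.1 s)
      ⟨g.2.2, by
        have hfg' : f.1 OnePoint.infty = g.1 OnePoint.infty := hfg
        rw [hfg']
        simpa only [hsum] using htend g⟩
    have h3 : ∀ n : ℕ, f.1 n = g.1 n := fun n => by
      rw [← hsum f, ← hsum g]
      exact Finset.sum_congr rfl fun s _ => congrFun (h1.trans h2.symm) s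
    refine Subtype.ext (ContinuousMap.ext fun k => ?_)
    induction k using OnePoint.rec with
    | infty => exact hfg
    | coe n => exact h3 n
  have hsurj : Function.Surjective (ev OnePoint.infty) := by
    intro x
    obtain ⟨y, ⟨hy, hy'⟩, -⟩ := hV.existsUnique x
    refine ⟨⟨OnePoint.continuousMapMkNat _ x hy', ?_, fun s => ?_⟩, rfl⟩
    · change ∑ s ∈ Finset.range 0, y s = 0
      simp
    · change ∑ s ∈ Finset.range (s + 1), y s - ∑ s ∈ Finset.range s, y s ∈ V s
      rw [Finset.sum_range_succ, add_sub_cancel_left]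
      exact hy s
  -- The open mapping theorem: the inverse is bounded, and its norm bounds all partial sums at once.
  let T : partialSums V ≃L[ℂ] X := ContinuousLinearEquiv.ofBijective (ev OnePoint.infty)
    (LinearMap.ker_eq_bot.2 hinj) (LinearMap.range_eq_top.2 hsurj)
  have hT : ∀ x, (T.symm x).1 OnePoint.infty = x := fun x => T.apply_symm_apply x
  let Q (s : ℕ) : X →L[ℂ] X := (ev (s + 1 : ℕ) - ev s) ∘L (T.symm : X →L[ℂ] partialSums V)
  have hQ : ∀ n x, ∑ s ∈ Finset.range n, Q s x = (T.symm x).1 n := fun n x => hsum _ n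
  refine ⟨Q, fun s x => (T.symm x).2.2 s, fun x => ?_, ‖(T.symm : X →L[ℂ] partialSums V)‖,
    fun n x => ?_⟩
  · simp only [hQ]
    simpa only [hT] using htend (T.symm x)
  · rw [hQ]
    exact ((T.symm x).1.norm_coe_le_norm _).trans
      ((T.symm : X →L[ℂ] partialSums V).le_opNorm x)

/-- A coordinate of the expansions with respect to `V` commutes with every bounded operator that
leaves all `V s` invariant. -/
theorem IsSchauderDecomposition.coord_comm (hV : IsSchauderDecomposition V) {Q : ℕ → X →L[ℂ] X}
    (hQ : ∀ s x, Q s x ∈ V s)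
    (hQ' : ∀ x, Tendsto (fun n => ∑ s ∈ Finset.range n, Q s x) atTop (𝓝 x))
    {T : X →L[ℂ] X} (hT : ∀ s, ∀ x ∈ V s, T x ∈ V s) (s : ℕ) (x : X) : Q s (T x) = T (Q s x) := by
  obtain ⟨y, -, hy⟩ := hV.existsUnique (T x)
  have h1 := hy (fun s => Q s (T x)) ⟨fun s => hQ s _, hQ' _⟩
  -- Applying `T` termwise to the expansion of `x` gives an admissible expansion of `T x`;
  -- uniqueness identifies it with the other one.
  have h2 := hy (fun s => T (Q s x)) ⟨fun s => hT s _ (hQ s _), by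
    simpa [Function.comp_def] using (T.continuous.tendsto x).comp (hQ' x)⟩
  exact congrFun (h1.trans h2.symm) s

/-- Such a vector is its own one-term expansion, and uniqueness excludes any other. This gives
biorthogonality of the final basis. -/
theorem IsSchauderDecomposition.coord_of_mem (hV : IsSchauderDecomposition V) {Q : ℕ → X →L[ℂ] X}
    (hQ : ∀ s x, Q s x ∈ V s)
    (hQ' : ∀ x, Tendsto (fun n => ∑ s ∈ Finset.range n, Q s x) atTop (𝓝 x))
    {t : ℕ} {x : X} (hx : x ∈ V t) (s : ℕ) : Q s x = (Pi.single t x : ℕ → X) s := by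
  obtain ⟨y, -, hy⟩ := hV.existsUnique x
  have h1 := hy (fun s => Q s x) ⟨fun s => hQ s _, hQ' _⟩
  have h2 := hy (Pi.single t x) ⟨fun s => by
    rcases eq_or_ne s t with rfl | h
    · simpa using hx
    · simp [h], by
    refine tendsto_const_nhds.congr' ?_
    filter_upwards [eventually_gt_atTop t] with n hn
    rw [Finset.sum_eq_single t] <;> simp +contextual [hn]⟩
  exact congrFun (h1.trans h2.symm) s

end Decomposition

/-! ### Partial sums along the shell enumeration -/

section Shell

theorem shell_of_le {i j : ℕ} (h : i ≤ j) : shell i j = j ^ 2 + i := if_pos h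

/-- Block l consists of the numbers l², …, l² + 2l. The offset from l² is at most l on the arm j = l
and runs from l + 1 to 2l on the arm i = l. -/
theorem shell_of_lt {i j : ℕ} (h : j < i) : shell i j = i ^ 2 + (2 * i - j) := by
  have h2 : (i + 1) ^ 2 = i ^ 2 + 2 * i + 1 := by ring
  rw [shell, if_neg (by omega)]
  omega

variable {E : Type*} [AddCommGroup E] {a : ℕ → E} {T : ℕ → ℕ → E}

/-- The first arm of block l is (0, l), …, (l, l). It includes the corner, so `r` may reach l + 1.
-/
theorem sum_range_sq_add_of_le (ha : ∀ i j, a (shell i j) = T i j) {l r : ℕ} (hr : r ≤ l + 1) :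
    ∑ k ∈ Finset.range (l ^ 2 + r), a k
      = ∑ k ∈ Finset.range (l ^ 2), a k + ∑ i ∈ Finset.range r, T i l := by
  rw [Finset.sum_range_add]
  congr 1
  refine Finset.sum_congr rfl fun i hi => ?_
  rw [← ha, shell_of_le]
  have := Finset.mem_range.1 hi
  omega

/-- The second arm runs downwards from (l, l − 1) to (l, 0), so after `r` terms it has covered l − r
≤ j < l. Writing this as a difference of initial sums lets bounds on initial partial sums apply. -/
theorem sum_range_sq_add_add (ha : ∀ i j, a (shell i j) = T i j) {l r : ℕ} (hr : r ≤ l) :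
    ∑ k ∈ Finset.range (l ^ 2 + (l + 1) + r), a k
      = ∑ k ∈ Finset.range (l ^ 2), a k + ∑ i ∈ Finset.range (l + 1), T i l
        + (∑ j ∈ Finset.range l, T l j - ∑ j ∈ Finset.range (l - r), T l j) := by
  rw [Finset.sum_range_add, sum_range_sq_add_of_le ha le_rfl]
  congr 1
  induction r with
  | zero => simp
  | succ r ih =>
    have e : l - r = (l - (r + 1)) + 1 := by omega
    rw [Finset.sum_range_succ, ih (by omega), e, Finset.sum_range_succ, ← ha l (l - (r + 1)),
      shell_of_lt (by omega)]
    have e' : l ^ 2 + (2 * l - (l - (r + 1))) = l ^ 2 + (l + 1) + r := by omega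
    rw [e']
    abel

theorem sum_range_sq (ha : ∀ i j, a (shell i j) = T i j) (l : ℕ) :
    ∑ k ∈ Finset.range (l ^ 2), a k = ∑ j ∈ Finset.range l, ∑ i ∈ Finset.range l, T i j := by
  induction l with
  | zero => simp
  | succ l ih =>
    have e : (l + 1) ^ 2 = l ^ 2 + (l + 1) + l := by ring
    rw [e, sum_range_sq_add_add ha le_rfl, ih]
    simp only [Finset.sum_range_succ, Finset.sum_add_distrib, Nat.sub_self, Finset.sum_range_zero,
      sub_zero]
    abel

end Shell

/-! ### Schauder bases from two commuting decompositions. -/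

section Basis

variable {X : Type*} [NormedAddCommGroup X] [NormedSpace ℂ X]

/-- The double series `∑ R i (Q j x)` of two commuting families of operators, each of which sums to
the identity with bounded partial sums, converges to `x` along the shell enumeration. -/
theorem tendsto_sum_shell {Q R : ℕ → X →L[ℂ] X}
    (hQ : ∀ x, Tendsto (fun n => ∑ s ∈ Finset.range n, Q s x) atTop (𝓝 x))
    (hR : ∀ x, Tendsto (fun n => ∑ s ∈ Finset.range n, R s x) atTop (𝓝 x))
    {C D : ℝ} (hC : ∀ n x, ‖∑ s ∈ Finset.range n, Q s x‖ ≤ C * ‖x‖)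
    (hD : ∀ n x, ‖∑ s ∈ Finset.range n, R s x‖ ≤ D * ‖x‖)
    (hQR : ∀ i j x, R i (Q j x) = Q j (R i x)) {x : X} {a : ℕ → X}
    (ha : ∀ i j, a (shell i j) = R i (Q j x)) :
    Tendsto (fun n => ∑ k ∈ Finset.range n, a k) atTop (𝓝 x) := by
  -- The terms of a convergent series tend to 0. This is pointwise in `x`, which suffices because
  -- the tail of block l only involves `Q l x` and `R l x`.
  have hzero : ∀ {Q : ℕ → X →L[ℂ] X},
      (∀ x, Tendsto (fun n => ∑ s ∈ Finset.range n, Q s x) atTop (𝓝 x)) →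
      Tendsto (fun n => ‖Q n x‖) atTop (𝓝 0) := by
    intro Q hQ
    have h := ((hQ x).comp (tendsto_add_atTop_nat 1)).sub (hQ x)
    simpa [Function.comp_def, Finset.sum_range_succ] using h.norm
  -- The constant itself has no assumed sign; only its products with norms are needed.
  have hC0 : ∀ n x, 0 ≤ C * ‖x‖ := fun n x => (norm_nonneg _).trans (hC n x)
  have hD0 : ∀ n x, 0 ≤ D * ‖x‖ := fun n x => (norm_nonneg _).trans (hD n x)
  have hsq : Tendsto (fun l => ‖∑ k ∈ Finset.range (l ^ 2), a k - x‖) atTop (𝓝 0) := by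
    have h1 : Tendsto (fun l => C * ‖∑ i ∈ Finset.range l, R i x - x‖
        + ‖∑ j ∈ Finset.range l, Q j x - x‖) atTop (𝓝 0) := by
      simpa using ((tendsto_iff_norm_sub_tendsto_zero.1 (hR x)).const_mul C).add
        (tendsto_iff_norm_sub_tendsto_zero.1 (hQ x))
    refine squeeze_zero (fun _ => norm_nonneg _) (fun l => ?_) h1
    -- With S and S' the l-th partial-sum operators of `Q` and `R`, this is S S' x − x = S(S' x − x)
    -- + (S x − x); the uniform bound `C` on S controls the first summand.
    have e : ∑ k ∈ Finset.range (l ^ 2), a k - x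
        = ∑ j ∈ Finset.range l, Q j (∑ i ∈ Finset.range l, R i x - x)
          + (∑ j ∈ Finset.range l, Q j x - x) := by
      rw [sum_range_sq ha]
      simp [hQR, map_sum, Finset.sum_sub_distrib]
    rw [e]
    exact (norm_add_le _ _).trans (add_le_add_left (hC _ _) _)
  -- The integer square root of n is the index of the block reached after n terms.
  have hsqrt : Tendsto Nat.sqrt atTop atTop :=
    tendsto_atTop.2 fun b => (eventually_ge_atTop (b ^ 2)).mono fun n hn => Nat.le_sqrt'.2 hn
  -- Three errors: the completed square, the first arm (a partial sum of `R` at `Q l x`), and the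
  -- second arm (a difference of two partial sums of `Q` at `R l x`, hence `C` twice).
  have hlim : Tendsto (fun l => ‖∑ k ∈ Finset.range (l ^ 2), a k - x‖ + D * ‖Q l x‖
      + (C * ‖R l x‖ + C * ‖R l x‖)) atTop (𝓝 0) := by
    simpa using (hsq.add ((hzero hQ).const_mul D)).add
      (((hzero hR).const_mul C).add ((hzero hR).const_mul C))
  rw [tendsto_iff_norm_sub_tendsto_zero]
  refine squeeze_zero (fun _ => norm_nonneg _) (fun n => ?_) (hlim.comp hsqrt)
  simp only [Function.comp_apply]
  have h1 := Nat.sqrt_le' n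
  have h2 := Nat.lt_succ_sqrt' n
  set l := Nat.sqrt n
  have h3 : l.succ ^ 2 = l ^ 2 + 2 * l + 1 := by rw [Nat.succ_eq_add_one]; ring
  rcases le_or_gt (n - l ^ 2) (l + 1) with h | h
  · have e : n = l ^ 2 + (n - l ^ 2) := by omega
    rw [e, sum_range_sq_add_of_le ha h, add_sub_right_comm]
    refine (norm_add_le _ _).trans ((add_le_add_right (hD _ _) _).trans ?_)
    linarith [hC0 0 (R l x)]
  · have e : n = l ^ 2 + (l + 1) + (n - (l ^ 2 + (l + 1))) := by omega
    rw [e, sum_range_sq_add_add ha (by omega), add_assoc, add_sub_right_comm, add_assoc]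
    -- Commutation turns the terms of the second arm into values of the `Q j` at the single vector
    -- `R l x`.
    simp only [hQR l]
    refine (norm_add_le _ _).trans (add_le_add_right ?_ _)
    refine (norm_add_le _ _).trans (add_le_add (hD _ _) ?_)
    exact (norm_sub_le _ _).trans (add_le_add (hC _ _) (hC _ _))

/-- Two Schauder decompositions `V` and `W` given by commuting projections, such that each
`V j ⊓ W i` is the line through a vector `e i j`, yield a Schauder basis along the shell
enumeration. -/
theorem exists_schauderBasis_shell [CompleteSpace X] {F G : ℕ → X →L[ℂ] X}
    (hF : IsSchauderDecomposition fun j => (F j).range)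
    (hG : IsSchauderDecomposition fun i => (G i).range)
    (hFF : ∀ j x, F j (F j x) = F j x) (hGG : ∀ i x, G i (G i x) = G i x)
    (hFG : ∀ i j x, F j (G i x) = G i (F j x)) (e : ℕ → ℕ → X)
    (he : ∀ i j, e i j ≠ 0) (heF : ∀ i j, F j (e i j) = e i j) (heG : ∀ i j, G i (e i j) = e i j)
    (hspan : ∀ i j x, ∃ c : ℂ, F j (G i x) = c • e i j) :
    ∃ b : SchauderBasis ℂ X, ∀ i j, b (shell i j) = e i j := by
  obtain ⟨Q, hQ, hQ', C, hC⟩ := hF.exists_coord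
  obtain ⟨R, hR, hR', D, hD⟩ := hG.exists_coord
  have hFQ : ∀ j x, F j (Q j x) = Q j x := fun j x => by
    obtain ⟨y, hy⟩ := hQ j x
    rw [← hy]
    exact hFF j y
  have hGR : ∀ i x, G i (R i x) = R i x := fun i x => by
    obtain ⟨y, hy⟩ := hR i x
    rw [← hy]
    exact hGG i y
  -- Commutation is transferred twice. Since `G i` commutes with every `F j`, it preserves their
  -- ranges and so commutes with `Q j`; then `Q j` preserves the ranges of the `G i` and so commutes
  -- with `R i`.
  have hQG : ∀ i j x, Q j (G i x) = G i (Q j x) := fun i j x =>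
    hF.coord_comm hQ hQ' (T := G i) (by
      rintro j _ ⟨y, rfl⟩
      exact ⟨G i y, hFG i j y⟩) j x
  have hRQ : ∀ i j x, R i (Q j x) = Q j (R i x) := fun i j x =>
    hG.coord_comm hR hR' (T := Q j) (by
      rintro i _ ⟨y, rfl⟩
      exact ⟨Q j y, (hQG i j y).symm⟩) i x
  -- A Hahn–Banach functional normalised at `e i j`. It is only evaluated on the line through `e i
  -- j`, where it reads off the coefficient, so its choice is immaterial.
  have hex : ∀ i j, ∃ f : StrongDual ℂ X, f (e i j) = 1 := fun i j => by
    obtain ⟨f, -, hf⟩ := exists_dual_vector ℂ (e i j) (norm_ne_zero_iff.2 (he i j))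
    refine ⟨((‖e i j‖ : ℂ)⁻¹) • f, ?_⟩
    have : (‖e i j‖ : ℂ) ≠ 0 := by exact_mod_cast norm_ne_zero_iff.2 (he i j)
    rw [smul_apply, hf]
    exact inv_mul_cancel₀ this
  choose f hf using hex
  have hterm : ∀ i j x, f i j (R i (Q j x)) • e i j = R i (Q j x) := fun i j x => by
    -- The double component lies in the ranges of both `G i` and `F j`, hence on the line given by
    -- `hspan`.
    have h1 : R i (Q j x) = F j (G i (R i (Q j x))) := by rw [hGR, hRQ, hFQ]
    obtain ⟨c, hc⟩ := hspan i j (R i (Q j x))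
    rw [h1, hc, map_smul, hf, smul_eq_mul, mul_one]
  let σ : ℕ × ℕ ≃ ℕ := Equiv.ofBijective _ shell_bijective
  have hσ : ∀ i j, σ.symm (shell i j) = (i, j) := fun i j => σ.symm_apply_apply (i, j)
  refine ⟨⟨fun k => e (σ.symm k).1 (σ.symm k).2,
    fun k => f (σ.symm k).1 (σ.symm k).2 ∘L R (σ.symm k).1 ∘L Q (σ.symm k).2, fun k l => ?_,
    fun x => ?_⟩, fun i j => by simp [hσ]⟩
  -- Biorthogonality: `e i' j'` is its own component in both decompositions, so `Q j` kills it
  -- unless j = j' and `R i` kills it unless i = i'.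
  · obtain ⟨⟨i, j⟩, rfl⟩ := σ.surjective k
    obtain ⟨⟨i', j'⟩, rfl⟩ := σ.surjective l
    simp only [σ.symm_apply_apply, ContinuousLinearMap.comp_apply]
    rw [hF.coord_of_mem hQ hQ' (t := j') ⟨_, heF i' j'⟩]
    rcases eq_or_ne j j' with rfl | hj
    · rw [Pi.single_eq_same, hG.coord_of_mem hR hR' (t := i') ⟨_, heG i' j⟩]
      rcases eq_or_ne i i' with rfl | hi
      · simp [hf]
      · simp [hi]
    · simp [hj]
  -- Summation in a `SchauderBasis` is conditional, so it means convergence of the partial sums over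
  -- initial segments.
  · rw [HasSum, SummationFilter.conditional_filter_eq_map_range, tendsto_map'_iff]
    refine tendsto_sum_shell hQ' hR' hC hD hRQ fun i j => ?_
    simp only [hσ]
    exact hterm i j x

end Basis

/-! ### The projections on `L^p(N ⊗ M)` -/

section ProjectionFormulas

variable {H : Type*} [NormedAddCommGroup H] [InnerProductSpace ℂ H] [CompleteSpace H]

/-- The inclusion of `L^p(N)` in the predual of `N`. -/
def Lp.toPredual {N : VonNeumannAlgebra H} {ω : Predual N} {p : ℝ≥0∞} [Fact (1 ≤ p)]
    (x : Lp N ω p) : Predual N :=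
  Interp.val (A₀ := El N) (A₁ := Predual N) (leftInj N ω) (param p) x

/-- Operator identities on L^p can be checked by evaluating functionals, with no norm estimate or
density argument. -/
theorem Lp.ext {N : VonNeumannAlgebra H} {ω : Predual N} {p : ℝ≥0∞} [Fact (1 ≤ p)]
    {x y : Lp N ω p} (h : ∀ z, x.toPredual z = y.toPredual z) : x = y :=
  Interp.val_injective (Predual.ext h)

theorem toPredual_smul {N : VonNeumannAlgebra H} {ω : Predual N} {p : ℝ≥0∞} [Fact (1 ≤ p)]
    (c : ℂ) (x : Lp N ω p) (y : El N) : (c • x).toPredual y = c * x.toPredual y := rfl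

theorem toPredual_toLp (N : VonNeumannAlgebra H) (ω : Predual N) (p : ℝ≥0∞) [Fact (1 ≤ p)]
    (x y : El N) : (toLp N ω p x).toPredual y = ω (y * x) := rfl

variable {K : Type*} [NormedAddCommGroup K] [InnerProductSpace ℂ K] [CompleteSpace K]
  {N : VonNeumannAlgebra H} {M : VonNeumannAlgebra K} {φ : Predual N} {ψ : Predual M}
  {p : ℝ≥0∞} [Fact (1 ≤ p)]

/-- Left multiplication on the predual is right multiplication of the argument, so the three factors
act on `y` in reverse order: y ↦ E_N(y(1 ⊗ v))(1 ⊗ v*). -/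
theorem toPredual_projLeft (v : El M) (x : Lp (vnTensor N M) (prodFunctional φ ψ) p)
    (y : El (vnTensor N M)) :
    (projLeft φ ψ p v x).toPredual y
      = x.toPredual (tmulEl (sliceToLeft N ψ.toDual (y * tmulEl 1 v)) (star v)) := by
  change x.toPredual (condExpLeft N ψ (y * tmulEl 1 v) * tmulEl 1 (star v)) = _
  congr 1
  exact (tmulEl_mul _ _ _ _).trans (by rw [mul_one, one_mul]; rfl)

theorem toPredual_projRight (u : El N) (x : Lp (vnTensor N M) (prodFunctional φ ψ) p)
    (y : El (vnTensor N M)) :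
    (projRight φ ψ p u x).toPredual y
      = x.toPredual (tmulEl (star u) (sliceToRight M φ.toDual (y * tmulEl u 1))) := by
  change x.toPredual (condExpRight M φ (y * tmulEl u 1) * tmulEl (star u) 1) = _
  congr 1
  exact (tmulEl_mul _ _ _ _).trans (by rw [mul_one, one_mul]; rfl)

/-- The slice map is a right `N`-module map, so `u` can be moved inside it, and φ ∘ (ι ⊗ ψ) is φ ⊗
ψ. -/
theorem map_sliceToLeft_mul (u : El N) (v : El M) (y : El (vnTensor N M)) :
    φ (sliceToLeft N ψ.toDual (y * tmulEl 1 v) * u) = prodFunctional φ ψ (y * tmulEl u v) := by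
  rw [prodFunctional_apply, ← sliceToLeft_mul_right, mul_assoc, tmulEl_mul, one_mul, mul_one]

theorem map_sliceToRight_mul (u : El N) (v : El M) (y : El (vnTensor N M)) :
    ψ (sliceToRight M φ.toDual (y * tmulEl u 1) * v) = prodFunctional φ ψ (y * tmulEl u v) := by
  rw [prodFunctional_apply', ← sliceToRight_mul_right, mul_assoc, tmulEl_mul, one_mul, mul_one]

theorem tmulEl_smul_left (c : ℂ) (x : El N) (y : El M) : tmulEl (c • x) y = c • tmulEl x y :=
  El.ext (htensor_ext fun a b => by simp)

theorem tmulEl_smul_right (c : ℂ) (x : El N) (y : El M) : tmulEl x (c • y) = c • tmulEl x y :=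
  El.ext (htensor_ext fun a b => by simp)

/-- One application turns the argument into n ⊗ v*. Multiplying by 1 ⊗ v leaves n ⊗ 1, and slicing
returns ψ(1) n = n. -/
theorem projLeft_projLeft (hψ : ψ 1 = 1) {v : El M} (hv : v ∈ unitary (El M))
    (x : Lp (vnTensor N M) (prodFunctional φ ψ) p) :
    projLeft φ ψ p v (projLeft φ ψ p v x) = projLeft φ ψ p v x := by
  refine Lp.ext fun y => ?_
  rw [toPredual_projLeft, toPredual_projLeft, toPredual_projLeft, tmulEl_mul, mul_one,
    Unitary.star_mul_self_of_mem hv, sliceToLeft_tmul, hψ, one_smul]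

theorem projRight_projRight (hφ : φ 1 = 1) {u : El N} (hu : u ∈ unitary (El N))
    (x : Lp (vnTensor N M) (prodFunctional φ ψ) p) :
    projRight φ ψ p u (projRight φ ψ p u x) = projRight φ ψ p u x := by
  refine Lp.ext fun y => ?_
  rw [toPredual_projRight, toPredual_projRight, toPredual_projRight, tmulEl_mul, mul_one,
    Unitary.star_mul_self_of_mem hu, sliceToRight_tmul, hφ, one_smul]

/-- Put n = (ι ⊗ ψ)(y(1 ⊗ v)). The second slice reduces the argument to φ(nu) u* ⊗ v*, and φ(nu) =
ω(y(u ⊗ v)) is the functional of i^p(u ⊗ v) at `y`. -/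
theorem projLeft_projRight (u : El N) (v : El M)
    (x : Lp (vnTensor N M) (prodFunctional φ ψ) p) :
    projLeft φ ψ p v (projRight φ ψ p u x) = x.toPredual (tmulEl (star u) (star v)) •
      toLp (vnTensor N M) (prodFunctional φ ψ) p (tmulEl u v) := by
  refine Lp.ext fun y => ?_
  rw [toPredual_projLeft, toPredual_projRight, tmulEl_mul, mul_one, sliceToRight_tmul,
    map_sliceToLeft_mul, tmulEl_smul_right, map_smul, toPredual_smul, toPredual_toLp, smul_eq_mul,
    mul_comm]

/-- The same rank-one operator as in `projLeft_projRight`, since ω is also ψ ∘ (φ ⊗ ι); together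
they give commutation. -/
theorem projRight_projLeft (u : El N) (v : El M)
    (x : Lp (vnTensor N M) (prodFunctional φ ψ) p) :
    projRight φ ψ p u (projLeft φ ψ p v x) = x.toPredual (tmulEl (star u) (star v)) •
      toLp (vnTensor N M) (prodFunctional φ ψ) p (tmulEl u v) := by
  refine Lp.ext fun y => ?_
  rw [toPredual_projRight, toPredual_projLeft, tmulEl_mul, mul_one, sliceToLeft_tmul,
    map_sliceToRight_mul, tmulEl_smul_left, map_smul, toPredual_smul, toPredual_toLp, smul_eq_mul,
    mul_comm]

theorem projLeft_toLp (hψ : ψ 1 = 1) (u : El N) {v : El M} (hv : v ∈ unitary (El M)) :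
    projLeft φ ψ p v (toLp (vnTensor N M) (prodFunctional φ ψ) p (tmulEl u v))
      = toLp (vnTensor N M) (prodFunctional φ ψ) p (tmulEl u v) := by
  refine Lp.ext fun y => ?_
  rw [toPredual_projLeft, toPredual_toLp, toPredual_toLp, tmulEl_mul,
    Unitary.star_mul_self_of_mem hv, prodFunctional_tmul, hψ, mul_one, map_sliceToLeft_mul]

theorem projRight_toLp (hφ : φ 1 = 1) {u : El N} (hu : u ∈ unitary (El N)) (v : El M) :
    projRight φ ψ p u (toLp (vnTensor N M) (prodFunctional φ ψ) p (tmulEl u v))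
      = toLp (vnTensor N M) (prodFunctional φ ψ) p (tmulEl u v) := by
  refine Lp.ext fun y => ?_
  rw [toPredual_projRight, toPredual_toLp, toPredual_toLp, tmulEl_mul,
    Unitary.star_mul_self_of_mem hu, prodFunctional_tmul, hφ, one_mul, map_sliceToRight_mul]

/-- Testing the functional on u* ⊗ v* gives ω(1) = 1. -/
theorem toLp_tmulEl_ne_zero (hφ : φ 1 = 1) (hψ : ψ 1 = 1) {u : El N} (hu : u ∈ unitary (El N))
    {v : El M} (hv : v ∈ unitary (El M)) :
    toLp (vnTensor N M) (prodFunctional φ ψ) p (tmulEl u v) ≠ 0 := by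
  intro h0
  have h1 := toPredual_toLp (vnTensor N M) (prodFunctional φ ψ) p (tmulEl u v)
    (tmulEl (star u) (star v))
  rw [tmulEl_mul, Unitary.star_mul_self_of_mem hu, Unitary.star_mul_self_of_mem hv,
    prodFunctional_tmul, hφ, hψ, mul_one, h0] at h1
  exact zero_ne_one h1

end ProjectionFormulas

end NCLp

end

/-! ### The Schauder basis of L^p(N ⊗ M). -/

theorem mainTheorem5
    {H K : Type*} [NormedAddCommGroup H] [InnerProductSpace ℂ H] [CompleteSpace H]
    [NormedAddCommGroup K] [InnerProductSpace ℂ K] [CompleteSpace K]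
    (N : VonNeumannAlgebra H) (M : VonNeumannAlgebra K)
    (φ : NCLp.Predual N) (hφ : NCLp.IsFaithfulState φ)
    (ψ : NCLp.Predual M) (hψ : NCLp.IsFaithfulState ψ)
    (p : ℝ≥0∞) [Fact (1 ≤ p)]
    (u : ℕ → NCLp.El N) (hu : ∀ i, u i ∈ unitary (NCLp.El N)) (hu' : LinearIndependent ℂ u)
    (v : ℕ → NCLp.El M) (hv : ∀ j, v j ∈ unitary (NCLp.El M)) (hv' : LinearIndependent ℂ v)
    (hN : NCLp.IsSchauderDecomposition fun j => (NCLp.projLeft φ ψ p (v j)).range)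
    (hM : NCLp.IsSchauderDecomposition fun i => (NCLp.projRight φ ψ p (u i)).range) :
    ∃ b : SchauderBasis ℂ (NCLp.Lp (NCLp.vnTensor N M) (NCLp.prodFunctional φ ψ) p),
      ∀ i j, b (NCLp.shell i j) =
        NCLp.toLp (NCLp.vnTensor N M) (NCLp.prodFunctional φ ψ) p (NCLp.tmulEl (u i) (v j)) := by
  have hφ1 := hφ.map_one
  have hψ1 := hψ.map_one
  exact NCLp.exists_schauderBasis_shell hN hM
    (fun j => NCLp.projLeft_projLeft hψ1 (hv j)) (fun i => NCLp.projRight_projRight hφ1 (hu i))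
    (fun i j x => (NCLp.projLeft_projRight _ _ x).trans (NCLp.projRight_projLeft _ _ x).symm)
    (fun i j => NCLp.toLp (NCLp.vnTensor N M) (NCLp.prodFunctional φ ψ) p
      (NCLp.tmulEl (u i) (v j)))
    (fun i j => NCLp.toLp_tmulEl_ne_zero hφ1 hψ1 (hu i) (hv j))
    (fun i j => NCLp.projLeft_toLp hψ1 (u i) (hv j))
    (fun i j => NCLp.projRight_toLp hφ1 (hu i) (v j))
    (fun i j x => ⟨_, NCLp.projLeft_projRight (u i) (v j) x⟩)
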